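/- All maps are smooth; manifolds are real, finite-dimensional, Hausdorff, second-countable and connected. Let $\pi:Y\to X$ be a smooth fibre bundle, $n=\dim X$, with fibred coordinates $(x^\lambda,y^i)$; put $\omega=dx^1\wedge\dots\wedge dx^n$, $\omega_\lambda=\partial_\lambda\rfloor\omega$. Let $J^1Y$ be the first order jet manifold, with coordinates $(x^\lambda,y^i,y^i_\lambda)$, and let $\Pi=\bigwedge^nT^*X\otimes_YV^*Y\otimes_YTX$ be the Legendre bundle, with coordinates $(x^\lambda,y^i,p^\lambda_i)$. Let $L=\mathcal L\,\omega:J^1Y\to\bigwedge^nT^*X$ be a Lagrangian, $\widehat L:J^1Y\to\Pi$, $p^\lambda_i\circ\widehat L=\pi^\lambda_i=\partial\mathcal L/\partial y^i_\lambda$, its Legendre map, $N_L=\widehat L(J^1Y)$ its constraint space, and $H_L=\mathcal L\,\omega+\pi^\lambda_i(dy^i-y^i_\mu dx^\mu)\wedge\omega_\lambda$ its Poincaré–Cartan form. Assume that $L$ is almost regular: $N_L$ is a closed imbedded subbundle of $\Pi\to Y$, and $\widehat L:J^1Y\to N_L$ is a submersion with connected fibres. Let $H=p^\lambda_i\,dy^i\wedge\omega_\lambda-\mathcal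 H\,\omega$ be a Hamiltonian form on $\Pi$, i.e. the pull-back of the canonical form $p\,\omega+p^\lambda_i\,dy^i\wedge\omega_\lambda$ on $Z_Y=T^*Y\wedge(\bigwedge^{n-1}T^*X)$ by a section of $Z_Y\to\Pi$, and let $\widehat H:\Pi\to J^1Y$, $y^i_\lambda\circ\widehat H=\partial\mathcal H/\partial p^\lambda_i$, be its Hamiltonian map. Assume that $H$ is weakly associated with $L$: $\widehat L\circ\widehat H\circ\widehat L=\widehat L$, and at all points of $N_L$ $$H=p^\lambda_i\,dy^i\wedge\omega_\lambda-p^\lambda_i\,(y^i_\lambda\circ\widehat H)\,\omega+\widehat H^*L .$$ Then $\widehat L:J^1Y\to N_L$ has a global section. Moreover, let $r:X\to\Pi$ be a section with values in $N_L$ which satisfies the Hamilton equations $$\partial_\lambda y^i=\frac{\partial\mathcal H}{\partial p^\lambda_i},\qquad \partial_\lambda p^\lambda_i=-\frac{\partial\mathcal H}{\partial y^i}.$$ Then for every global section $\Psi$ of $\widehat L:J^1Y\to N_L$, $r$ satisfies the constrained Hamilton equations $$r^*(u_N\rfloor dH_N)=0,\qquad H_N=\Psi^*H_L,$$ for every vertical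 vector field $u_N$ on $N_L\to X$. -/

import Mathlib

open Set Filter Topology
open scoped Manifold ContDiff

namespace Polysymplectic

/-! ### Model spaces and coordinate forms -/

/-- Model space of the base (dimension `n`) or of the typical fibre (dimension `m`). -/
abbrev Model (n : ℕ) : Type := EuclideanSpace ℝ (Fin n)

/-- Arrays `v λ i`: jet coordinates `y^i_λ` or momentum coordinates `p^λ_i`. -/
abbrev Arr (n m : ℕ) : Type := Fin n → Fin m → ℝ

/-- Model space of the jet manifold, coordinates `((x, y), y^i_λ)`, and of the Legendre bundle,
coordinates `((x, y), p^λ_i)`. -/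
abbrev Coord (n m : ℕ) : Type := (Model n × Model m) × Arr n m

/-- The array with a single entry `1`, at `(lam, i)`. -/
def unitArr {n m : ℕ} (lam : Fin n) (i : Fin m) : Arr n m := Pi.single lam (Pi.single i 1)

/-- The linear map `dx^λ ⊗ v^i_λ ∂_i` from the base model to the fibre model. -/
noncomputable def velMap {n m : ℕ} (v : Arr n m) : Model n →L[ℝ] Model m :=
  ∑ lam, (EuclideanSpace.proj lam : Model n →L[ℝ] ℝ).smulRight (WithLp.toLp 2 (v lam) : Model m)

/-- The determinant as a continuous alternating form on `Fin n → ℝ`. -/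
noncomputable def detForm (n : ℕ) : (Fin n → ℝ) [⋀^Fin n]→L[ℝ] ℝ :=
  { (Matrix.detRowAlternating : (Fin n → ℝ) [⋀^Fin n]→ₗ[ℝ] ℝ) with
    cont := by
      change Continuous fun M : Fin n → Fin n → ℝ => Matrix.det (Matrix.of M)
      exact Continuous.matrix_det continuous_id }

/-- The exterior product `α 0 ∧ ⋯ ∧ α (n - 1)` of `n` covectors. -/
noncomputable def wedge {n : ℕ} {W : Type*} [AddCommGroup W] [Module ℝ W] [TopologicalSpace W]
    (α : Fin n → W →L[ℝ] ℝ) : W [⋀^Fin n]→L[ℝ] ℝ :=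
  (detForm n).compContinuousLinearMap (ContinuousLinearMap.pi α)

/-- The covector `dx^λ`. -/
noncomputable def dxForm {n m : ℕ} (lam : Fin n) : Coord n m →L[ℝ] ℝ :=
  (EuclideanSpace.proj lam : Model n →L[ℝ] ℝ).comp
    ((ContinuousLinearMap.fst ℝ (Model n) (Model m)).comp
      (ContinuousLinearMap.fst ℝ (Model n × Model m) (Arr n m)))

/-- The covector `dy^i`. -/
noncomputable def dyForm {n m : ℕ} (i : Fin m) : Coord n m →L[ℝ] ℝ :=
  (EuclideanSpace.proj i : Model m →L[ℝ] ℝ).comp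
    ((ContinuousLinearMap.snd ℝ (Model n) (Model m)).comp
      (ContinuousLinearMap.fst ℝ (Model n × Model m) (Arr n m)))

/-- The form `ω = dx^1 ∧ ⋯ ∧ dx^n`. -/
noncomputable def volForm (n m : ℕ) : Coord n m [⋀^Fin n]→L[ℝ] ℝ :=
  wedge (fun mu => dxForm mu)

/-- The form `α ∧ ω_λ`, where `ω_λ` is the contraction of `ω` with `∂_λ`: in the product
`dx^1 ∧ ⋯ ∧ dx^n` the factor `dx^λ` is replaced by the covector `α`. -/
noncomputable def wedgeOmega {n m : ℕ} (α : Coord n m →L[ℝ] ℝ) (lam : Fin n) :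
    Coord n m [⋀^Fin n]→L[ℝ] ℝ :=
  wedge (Function.update (fun mu => dxForm mu) lam α)

/-- Pull-back of a form along a map of normed spaces. -/
noncomputable def pullback {W W' : Type*} [NormedAddCommGroup W] [NormedSpace ℝ W]
    [NormedAddCommGroup W'] [NormedSpace ℝ W'] {n : ℕ} (g : W → W')
    (η : W' → W' [⋀^Fin n]→L[ℝ] ℝ) (z : W) : W [⋀^Fin n]→L[ℝ] ℝ :=
  (η (g z)).compContinuousLinearMap (fderiv ℝ g z)

/-! ### The fibre bundle, its jets and its Legendre bundle -/

section Bundle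

variable (n m : ℕ) {X Y : Type*}
  [TopologicalSpace X] [ChartedSpace (Model n) X]
  [TopologicalSpace Y] [ChartedSpace (Model n × Model m) Y]

/-- The tangent space of the base `X`. -/
abbrev TX (x : X) : Type := TangentSpace 𝓘(ℝ, Model n) x

/-- The tangent space of the total space `Y`. -/
abbrev TY (y : Y) : Type := TangentSpace 𝓘(ℝ, Model n × Model m) y

/-- The tangent map of the projection. -/
noncomputable abbrev dProj (π : Y → X) (y : Y) : TY n m y →L[ℝ] TX n (π y) :=
  mfderiv 𝓘(ℝ, Model n × Model m) 𝓘(ℝ, Model n) π y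

/-- `π : Y → X` is a smooth locally trivial fibre bundle with typical fibre `M`. -/
def IsSmoothFibreBundle (M : Type*) [TopologicalSpace M] [ChartedSpace (Model m) M]
    (π : Y → X) : Prop :=
  ContMDiff 𝓘(ℝ, Model n × Model m) 𝓘(ℝ, Model n) ∞ π ∧
  ∀ x : X, ∃ e : Bundle.Trivialization M π, x ∈ e.baseSet ∧
    ContMDiffOn 𝓘(ℝ, Model n × Model m) (𝓘(ℝ, Model n).prod 𝓘(ℝ, Model m)) ∞ e e.source ∧
    ContMDiffOn (𝓘(ℝ, Model n).prod 𝓘(ℝ, Model m)) 𝓘(ℝ, Model n × Model m) ∞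
      e.toOpenPartialHomeomorph.symm e.target

/-- The vector space `T^*_x X ⊗ V_y Y` (`x = π y`) of linear maps from the tangent space of the
base to the vertical tangent space. -/
def VertHom (π : Y → X) (y : Y) : Submodule ℝ (TX n (π y) →L[ℝ] TY n m y) where
  carrier := {φ | ∀ u, dProj n m π y (φ u) = 0}
  add_mem' := by
    intro a b ha hb u
    simp only [mem_ofPred_eq] at ha hb
    simp [ha u, hb u]
  zero_mem' := by intro u; simp
  smul_mem' := by
    intro t a ha u
    simp only [mem_ofPred_eq] at ha
    simp [ha u]

/-- The fibre `J^1_y Y` of the first order jet manifold: the `1`-jet at `x = π y` of a section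
through `y` is its tangent map, a linear right inverse of the tangent map of the projection. -/
abbrev JetFibre (π : Y → X) (y : Y) : Type :=
  {A : TX n (π y) →L[ℝ] TY n m y // ∀ u, dProj n m π y (A u) = u}

/-- The affine structure of the jet bundle. -/
noncomputable def JetFibre.translate {π : Y → X} {y : Y} (A : JetFibre n m π y) (φ : VertHom n m π y) :
    JetFibre n m π y :=
  ⟨A.1 + φ.1, fun u => by
    have h : dProj n m π y (φ.1 u) = 0 := φ.2 u
    simp [A.2 u, h]⟩

/-- Exterior forms of degree `n = dim X` on the tangent space `T_x X`. -/
abbrev Density (x : X) : Type := TX n x [⋀^Fin n]→L[ℝ] ℝ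

/-- The fibre `⋀^n T^*_x X ⊗ V^*_y Y ⊗ T_x X` of the Legendre bundle, as the space of linear maps
from `T^*_x X ⊗ V_y Y` to `⋀^n T^*_x X`. -/
abbrev LegFibre (π : Y → X) (y : Y) : Type :=
  VertHom n m π y →ₗ[ℝ] Density n (π y)

/-- The total space of the Legendre bundle. -/
abbrev Leg (π : Y → X) : Type _ := Σ y : Y, LegFibre n m π y

/-- A fibred chart: a chart of `Y` over a chart of `X`, so that its first `n` coordinates are
those of the base point. -/
structure FibredChart (π : Y → X) where
  base : OpenPartialHomeomorph X (Model n)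
  total : OpenPartialHomeomorph Y (Model n × Model m)
  base_mem : base ∈ IsManifold.maximalAtlas 𝓘(ℝ, Model n) ∞ X
  total_mem : total ∈ IsManifold.maximalAtlas 𝓘(ℝ, Model n × Model m) ∞ Y
  proj_mem : ∀ y ∈ total.source, π y ∈ base.source
  fst_total : ∀ y ∈ total.source, (total y).1 = base (π y)

namespace FibredChart

variable {n m} {π : Y → X} (c : FibredChart n m π)

/-- The tangent map of the base chart. -/
noncomputable def dX (x : X) : TX n x →L[ℝ] Model n :=
  mfderiv 𝓘(ℝ, Model n) 𝓘(ℝ, Model n) c.base x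

/-- The tangent map of the chart of the total space. -/
noncomputable def dY (y : Y) : TY n m y →L[ℝ] Model n × Model m :=
  mfderiv 𝓘(ℝ, Model n × Model m) 𝓘(ℝ, Model n × Model m) c.total y

/-- The coordinate vector `∂_λ` of the base. -/
noncomputable def partialX (x : X) (lam : Fin n) : TX n x :=
  (c.dX x).inverse (EuclideanSpace.single lam 1)

/-- The coordinate vector `∂_λ` of the total space. -/
noncomputable def partialY (y : Y) (lam : Fin n) : TY n m y :=
  (c.dY y).inverse (EuclideanSpace.single lam 1, 0)

/-- The density `dx^1 ∧ ⋯ ∧ dx^n` on the tangent space of the base. -/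
noncomputable def vol (x : X) : Density n x :=
  wedge (fun mu => (EuclideanSpace.proj mu : Model n →L[ℝ] ℝ).comp (c.dX x))

theorem isInvertible_dX {x : X} (hx : x ∈ c.base.source) :
    (c.dX x).IsInvertible := by
  have h : c.base.MDifferentiable 𝓘(ℝ, Model n) 𝓘(ℝ, Model n) :=
    ⟨(contMDiffOn_of_mem_maximalAtlas c.base_mem).mdifferentiableOn (by simp),
     (contMDiffOn_symm_of_mem_maximalAtlas c.base_mem).mdifferentiableOn (by simp)⟩
  exact ⟨h.mfderiv hx, rfl⟩

theorem isInvertible_dY {y : Y}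
    (hy : y ∈ c.total.source) : (c.dY y).IsInvertible := by
  have h : c.total.MDifferentiable 𝓘(ℝ, Model n × Model m) 𝓘(ℝ, Model n × Model m) :=
    ⟨(contMDiffOn_of_mem_maximalAtlas c.total_mem).mdifferentiableOn (by simp),
     (contMDiffOn_symm_of_mem_maximalAtlas c.total_mem).mdifferentiableOn (by simp)⟩
  exact ⟨h.mfderiv hy, rfl⟩

/-- In a fibred chart the tangent map of the projection is the first projection. -/
theorem dX_dProj {y : Y} (hy : y ∈ c.total.source) (w : TY n m y) :
    c.dX (π y) (dProj n m π y w) = (c.dY y w).1 := by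
  have hb : c.base.MDifferentiable 𝓘(ℝ, Model n) 𝓘(ℝ, Model n) :=
    ⟨(contMDiffOn_of_mem_maximalAtlas c.base_mem).mdifferentiableOn (by simp),
     (contMDiffOn_symm_of_mem_maximalAtlas c.base_mem).mdifferentiableOn (by simp)⟩
  have ht : c.total.MDifferentiable 𝓘(ℝ, Model n × Model m) 𝓘(ℝ, Model n × Model m) :=
    ⟨(contMDiffOn_of_mem_maximalAtlas c.total_mem).mdifferentiableOn (by simp),
     (contMDiffOn_symm_of_mem_maximalAtlas c.total_mem).mdifferentiableOn (by simp)⟩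
  have hnhds : c.total.source ∈ 𝓝 y := c.total.open_source.mem_nhds hy
  have hfst : HasMFDerivAt 𝓘(ℝ, Model n × Model m) 𝓘(ℝ, Model n)
      (Prod.fst : Model n × Model m → Model n) (c.total y)
      (ContinuousLinearMap.fst ℝ (Model n) (Model m)) :=
    (hasFDerivAt_fst (𝕜 := ℝ) (p := c.total y)).hasMFDerivAt
  have h1 := hfst.comp y (ht.mdifferentiableAt hy).hasMFDerivAt
  have hs : MDifferentiableAt 𝓘(ℝ, Model n) 𝓘(ℝ, Model n) c.base.symm (c.total y).1 := by
    rw [c.fst_total y hy]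
    exact hb.mdifferentiableAt_symm (c.base.map_source (c.proj_mem y hy))
  have hπ : MDifferentiableAt 𝓘(ℝ, Model n × Model m) 𝓘(ℝ, Model n) π y := by
    have h2 := MDifferentiableAt.comp (I' := 𝓘(ℝ, Model n)) y (g := c.base.symm) hs
      h1.mdifferentiableAt
    refine h2.congr_of_eventuallyEq ?_
    filter_upwards [hnhds] with z hz
    simp only [Function.comp_apply, c.fst_total z hz]
    exact (c.base.left_inv (c.proj_mem z hz)).symm
  have h3 := (hb.mdifferentiableAt (c.proj_mem y hy)).hasMFDerivAt.comp y hπ.hasMFDerivAt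
  have h4 := h1.congr_of_eventuallyEq (f₁ := c.base ∘ π) (by
    filter_upwards [hnhds] with z hz
    simp only [Function.comp_apply, c.fst_total z hz])
  exact DFunLike.congr_fun (hasMFDerivAt_unique h3 h4) w

/-- The vertical homomorphism `v^i_λ dx^λ ⊗ ∂_i` at a point `y` of the chart domain. -/
noncomputable def vert (y : Y) (hy : y ∈ c.total.source) (v : Arr n m) : VertHom n m π y :=
  ⟨(c.dY y).inverse.comp
      ((ContinuousLinearMap.inr ℝ (Model n) (Model m)).comp ((velMap v).comp (c.dX (π y)))),
    fun u => by
      have hinj : Function.Injective (c.dX (π y)) :=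
        (c.isInvertible_dX (c.proj_mem y hy)).injective
      apply hinj
      rw [c.dX_dProj hy]
      simp [(c.isInvertible_dY hy).self_apply_inverse]⟩

/-- The jet at `y` with jet coordinates `v`. -/
noncomputable def jet (y : Y) (hy : y ∈ c.total.source) (v : Arr n m) : JetFibre n m π y :=
  ⟨(c.dY y).inverse.comp
      (((ContinuousLinearMap.id ℝ (Model n)).prod (velMap v)).comp (c.dX (π y))),
    fun u => by
      have hinj : Function.Injective (c.dX (π y)) :=
        (c.isInvertible_dX (c.proj_mem y hy)).injective
      apply hinj
      rw [c.dX_dProj hy]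
      simp [(c.isInvertible_dY hy).self_apply_inverse]⟩

/-- The jet coordinates `y^i_λ` of a jet. -/
noncomputable def jetCoord {y : Y} (A : JetFibre n m π y) : Arr n m :=
  fun lam i => (c.dY y (A.1 (c.partialX (π y) lam))).2 i

open Classical in
/-- The momentum coordinates `p^λ_i` of an element of the Legendre bundle over the chart domain:
its value on `dx^λ ⊗ ∂_i` is `p^λ_i dx^1 ∧ ⋯ ∧ dx^n`. -/
noncomputable def momCoord {y : Y} (p : LegFibre n m π y) : Arr n m :=
  fun lam i => if hy : y ∈ c.total.source then
    p (c.vert y hy (unitArr lam i)) (c.partialX (π y)) else 0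

/-- The element of the Legendre bundle at `y` with momentum coordinates `p`. -/
noncomputable def leg (y : Y) (p : Arr n m) : LegFibre n m π y where
  toFun φ := (∑ lam, ∑ i, p lam i * (c.dY y (φ.1 (c.partialX (π y) lam))).2 i) • c.vol (π y)
  map_add' φ ψ := by
    simp [mul_add, Finset.sum_add_distrib, add_smul]
  map_smul' t φ := by
    simp only [SetLike.val_smul, FunLike.coe_smul, Pi.smul_apply, map_smul, Prod.smul_snd,
      PiLp.smul_apply, smul_eq_mul, RingHom.id_apply, smul_smul, Finset.mul_sum]
    congr 1
    refine Finset.sum_congr rfl fun lam _ => Finset.sum_congr rfl fun i _ => ?_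
    ring

/-- The coordinates `((x, y), p^λ_i)` on the Legendre bundle. -/
noncomputable def legCoord {y : Y} (p : LegFibre n m π y) : Coord n m :=
  (c.total y, c.momCoord p)

open Classical in
/-- The function `𝓛` in the coordinate expression `L = 𝓛 ω` of a family of densities on jets. -/
noncomputable def lagr (L : ∀ y, JetFibre n m π y → Density n (π y)) : Coord n m → ℝ :=
  fun w => if hw : w.1 ∈ c.total.target then
    L (c.total.symm w.1) (c.jet (c.total.symm w.1) (c.total.map_target hw) w.2)
      (c.partialX (π (c.total.symm w.1))) else 0

/-- The function `𝓗` in the coordinate expression `p^λ_i dy^i ∧ ω_λ - 𝓗 ω` of the form `h p`. -/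
noncomputable def ham (h : ∀ y, LegFibre n m π y → TY n m y [⋀^Fin n]→L[ℝ] ℝ) :
    Coord n m → ℝ :=
  fun w => - h (c.total.symm w.1) (c.leg (c.total.symm w.1) w.2)
    (c.partialY (c.total.symm w.1))

end FibredChart

/-! ### Lagrangians and Hamiltonian forms -/

/-- A first order Lagrangian: a smooth bundle map `L : J^1 Y → ⋀^n T^* X` over `X`. -/
structure Lagrangian (π : Y → X) where
  toFun : ∀ y, JetFibre n m π y → Density n (π y)
  smooth : ∀ c : FibredChart n m π, ContDiffOn ℝ ∞ (c.lagr toFun) (c.total.target ×ˢ univ)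

/-- A Hamiltonian form, given by a smooth section `h` of the bundle `Z_Y → Π`. The fibre of
`Z_Y = T^*Y ∧ ⋀^{n-1} T^*X` at `y` consists of the `n`-forms on `T_y Y` which vanish on any two
vertical vectors. Pulled back by jets, such a form is an affine function of the jet, and its
projection to the Legendre bundle is the linear part of this function. -/
structure HamiltonianForm (π : Y → X) where
  toFun : ∀ y, LegFibre n m π y → TY n m y [⋀^Fin n]→L[ℝ] ℝ
  vertical : ∀ (y : Y) (p : LegFibre n m π y) (w : Fin n → TY n m y) (j k : Fin n), j ≠ k →
    dProj n m π y (w j) = 0 → dProj n m π y (w k) = 0 → toFun y p w = 0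
  proj : ∀ (y : Y) (p : LegFibre n m π y) (A : JetFibre n m π y) (φ : VertHom n m π y),
    (toFun y p).compContinuousLinearMap (JetFibre.translate n m A φ).1 =
      (toFun y p).compContinuousLinearMap A.1 + p φ
  smooth : ∀ c : FibredChart n m π, ContDiffOn ℝ ∞ (c.ham toFun) (c.total.target ×ˢ univ)

variable {n m} {π : Y → X}

namespace Lagrangian

variable (L : Lagrangian n m π)

/-- `p` is the image of the jet `A` under the Legendre map of `L`: the derivative of `L` at `A`
along the fibre of the jet bundle. In fibred coordinates this is `p^λ_i = ∂𝓛/∂y^i_λ`. -/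
def LegendreMap {y : Y} (A : JetFibre n m π y) (p : LegFibre n m π y) : Prop :=
  ∀ (φ : VertHom n m π y) (u : Fin n → TX n (π y)),
    HasDerivAt (fun t : ℝ => L.toFun y (JetFibre.translate n m A (t • φ)) u) (p φ u) 0

/-- The Lagrangian constraint space, the image of the Legendre map. -/
def constraintSpace (y : Y) : Set (LegFibre n m π y) :=
  {p | ∃ A : JetFibre n m π y, L.LegendreMap A p}

end Lagrangian

namespace FibredChart

variable (c : FibredChart n m π)

/-- The functions `π^λ_i = ∂𝓛/∂y^i_λ`. -/
noncomputable def momenta (L : Lagrangian n m π) (w : Coord n m) : Arr n m :=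
  fun lam i => fderiv ℝ (c.lagr L.toFun) w (0, unitArr lam i)

/-- The coordinate expression of the Legendre map. -/
noncomputable def legendre (L : Lagrangian n m π) (w : Coord n m) : Coord n m :=
  (w.1, c.momenta L w)

/-- The contact form `θ^i = dy^i - y^i_μ dx^μ` at a point with jet coordinates `v`. -/
noncomputable def contactForm (v : Arr n m) (i : Fin m) : Coord n m →L[ℝ] ℝ :=
  dyForm i - ∑ mu, v mu i • dxForm mu

/-- The Poincaré–Cartan form `H_L = 𝓛 ω + π^λ_i θ^i ∧ ω_λ` on the jet manifold. -/
noncomputable def poincareCartan (L : Lagrangian n m π) (w : Coord n m) :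
    Coord n m [⋀^Fin n]→L[ℝ] ℝ :=
  c.lagr L.toFun w • volForm n m +
    ∑ lam, ∑ i, c.momenta L w lam i • wedgeOmega (contactForm w.2 i) lam

/-- The Hamiltonian form `p^λ_i dy^i ∧ ω_λ - 𝓗 ω` on the Legendre bundle. -/
noncomputable def hamForm (H : HamiltonianForm n m π) (w : Coord n m) :
    Coord n m [⋀^Fin n]→L[ℝ] ℝ :=
  (∑ lam, ∑ i, w.2 lam i • wedgeOmega (dyForm i) lam) - c.ham H.toFun w • volForm n m

/-- The Hamiltonian form `p^λ_i dy^i ∧ ω_λ - p^λ_i Φ^i_λ ω` defined by a Hamiltonian map `Φ`, at a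
point with momentum coordinates `p` where `Φ` takes the jet coordinates `v`. -/
noncomputable def mapForm (p v : Arr n m) : Coord n m [⋀^Fin n]→L[ℝ] ℝ :=
  (∑ lam, ∑ i, p lam i • wedgeOmega (dyForm i) lam) -
    (∑ lam, ∑ i, p lam i * v lam i) • volForm n m

end FibredChart

/-- `Φ : Π → J^1 Y` is the Hamiltonian map of `H`: in fibred coordinates
`y^i_λ ∘ Φ = ∂𝓗/∂p^λ_i`. -/
def IsHamiltonianMap (H : HamiltonianForm n m π)
    (Φ : ∀ y, LegFibre n m π y → JetFibre n m π y) : Prop :=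
  ∀ (c : FibredChart n m π) (y : Y), y ∈ c.total.source → ∀ (p : LegFibre n m π y)
    (lam : Fin n) (i : Fin m),
    c.jetCoord (Φ y p) lam i = fderiv ℝ (c.ham H.toFun) (c.legCoord p) (0, unitArr lam i)

/-- `H` is weakly associated with `L`. Writing `Φ` for the Hamiltonian map of `H`, the composition
of the Legendre map, `Φ` and the Legendre map is the Legendre map, and `H = H_Φ + Φ^* L` holds at
the points of the Lagrangian constraint space. -/
def WeaklyAssociated (H : HamiltonianForm n m π) (L : Lagrangian n m π) : Prop :=
  ∃ Φ : ∀ y, LegFibre n m π y → JetFibre n m π y, IsHamiltonianMap H Φ ∧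
    (∀ (y : Y) (A : JetFibre n m π y) (p : LegFibre n m π y),
      L.LegendreMap A p → L.LegendreMap (Φ y p) p) ∧
    ∀ (c : FibredChart n m π) (y : Y), y ∈ c.total.source → ∀ p ∈ L.constraintSpace y,
      c.hamForm H (c.legCoord p) = FibredChart.mapForm (c.momCoord p) (c.jetCoord (Φ y p)) +
        c.lagr L.toFun (c.total y, c.jetCoord (Φ y p)) • volForm n m

/-! ### Subbundles of the Legendre bundle and almost regular Lagrangians -/

/-- An adapted chart, over a fibred chart `c`, of a subset `N` of the Legendre bundle `Π → Y` which
is an embedded submanifold fibred over `Y` with `k`-dimensional fibres. The coordinates are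
`((x, y), κ)`; on the open set `nbhd` of the coordinate space of `Π` the subset `N` is the image of
`((x, y), κ) ↦ ((x, y), mom ((x, y), κ))`, and `κ` is the restriction to `N` of the smooth
function `ret`. -/
structure AdaptedChart (c : FibredChart n m π) (N : ∀ y, Set (LegFibre n m π y)) (k : ℕ) where
  dom : Set ((Model n × Model m) × Model k)
  nbhd : Set (Coord n m)
  mom : (Model n × Model m) × Model k → Arr n m
  ret : Coord n m → Model k
  isOpen_dom : IsOpen dom
  isOpen_nbhd : IsOpen nbhd
  smooth_mom : ContDiffOn ℝ ∞ mom dom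
  smooth_ret : ContDiffOn ℝ ∞ ret nbhd
  fst_mem : ∀ z ∈ dom, z.1 ∈ c.total.target
  mem : ∀ z ∈ dom, c.leg (c.total.symm z.1) (mom z) ∈ N (c.total.symm z.1)
  mem_nbhd : ∀ z ∈ dom, (z.1, mom z) ∈ nbhd
  ret_mom : ∀ z ∈ dom, ret (z.1, mom z) = z.2
  mem_dom : ∀ y ∈ c.total.source, ∀ p ∈ N y, c.legCoord p ∈ nbhd →
    (c.total y, ret (c.legCoord p)) ∈ dom
  mom_ret : ∀ y ∈ c.total.source, ∀ p ∈ N y, c.legCoord p ∈ nbhd →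
    mom (c.total y, ret (c.legCoord p)) = c.momCoord p

/-- `N` is a closed embedded subbundle of the Legendre bundle `Π → Y`: it is closed in `Π`, it is
covered by adapted charts, and it is locally trivial over `Y` with a manifold `K` as typical
fibre; `T` and `t` are the fibre component of a local trivialization and its inverse. -/
def IsClosedSubbundle (N : ∀ y, Set (LegFibre n m π y)) : Prop :=
  (∀ c : FibredChart n m π, ∃ C : Set (Coord n m), IsClosed C ∧
    ∀ y ∈ c.total.source, ∀ p : LegFibre n m π y, p ∈ N y ↔ c.legCoord p ∈ C) ∧
  ∃ k : ℕ,
    (∀ (c : FibredChart n m π), ∀ y ∈ c.total.source, ∀ p ∈ N y,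
      ∃ S : AdaptedChart c N k, c.legCoord p ∈ S.nbhd) ∧
    ∃ (K : Type) (_ : TopologicalSpace K) (_ : ChartedSpace (Model k) K),
      IsManifold 𝓘(ℝ, Model k) ∞ K ∧ T2Space K ∧ SecondCountableTopology K ∧ ConnectedSpace K ∧
      ∀ y₀ : Y, ∃ c : FibredChart n m π, y₀ ∈ c.total.source ∧
        ∃ (T : ∀ y, LegFibre n m π y → K) (t : (Model n × Model m) × K → Arr n m),
          ContMDiffOn (𝓘(ℝ, Model n × Model m).prod 𝓘(ℝ, Model k)) 𝓘(ℝ, Arr n m) ∞ t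
            (c.total.target ×ˢ univ) ∧
          (∀ S : AdaptedChart c N k,
            ContMDiffOn 𝓘(ℝ, (Model n × Model m) × Model k) 𝓘(ℝ, Model k) ∞
              (fun z => T (c.total.symm z.1) (c.leg (c.total.symm z.1) (S.mom z))) S.dom) ∧
          (∀ y ∈ c.total.source, ∀ p ∈ N y, t (c.total y, T y p) = c.momCoord p) ∧
          (∀ z ∈ c.total.target, ∀ κ : K,
            c.leg (c.total.symm z) (t (z, κ)) ∈ N (c.total.symm z) ∧
            T (c.total.symm z) (c.leg (c.total.symm z) (t (z, κ))) = κ)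

/-- `L` is almost regular: the Lagrangian constraint space `N_L` is a closed embedded subbundle of
the Legendre bundle, and the Legendre map `J^1 Y → N_L` is a submersion with connected fibres. -/
structure IsAlmostRegular (L : Lagrangian n m π) : Prop where
  subbundle : IsClosedSubbundle L.constraintSpace
  submersion : ∀ (c : FibredChart n m π) (k : ℕ) (S : AdaptedChart c L.constraintSpace k)
    (w : Coord n m), w.1 ∈ c.total.target → c.legendre L w ∈ S.nbhd →
    Function.Surjective (fderiv ℝ (fun w' => (w'.1, S.ret (c.legendre L w'))) w)
  connected : ∀ (y : Y), ∀ p ∈ L.constraintSpace y,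
    IsConnected {A : JetFibre n m π y | L.LegendreMap A p}

/-! ### Hamilton equations and constrained Hamilton equations -/

variable (n m π) in
/-- A smooth section `r : X → Π` of the Legendre bundle over `X`. -/
structure LegSection where
  toFun : X → Leg n m π
  proj : ∀ x, π (toFun x).1 = x
  continuous_point : Continuous fun x => (toFun x).1
  smooth : ∀ c : FibredChart n m π,
    ContDiffOn ℝ ∞ (fun x => c.legCoord (toFun (c.base.symm x)).2)
      {x | x ∈ c.base.target ∧ (toFun (c.base.symm x)).1 ∈ c.total.source}

namespace LegSection

variable (r : LegSection n m π)

/-- The part of the coordinate space of `X` where `r` takes values in the domain of a chart. -/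
def coordDom (c : FibredChart n m π) : Set (Model n) :=
  {x | x ∈ c.base.target ∧ (r.toFun (c.base.symm x)).1 ∈ c.total.source}

/-- The coordinate expression `x ↦ ((x, y(x)), p(x))` of `r`. -/
noncomputable def coord (c : FibredChart n m π) (x : Model n) : Coord n m :=
  c.legCoord (r.toFun (c.base.symm x)).2

/-- `r` satisfies the Hamilton equations `∂_λ y^i = ∂𝓗/∂p^λ_i`, `∂_λ p^λ_i = - ∂𝓗/∂y^i`. -/
def SolvesHamilton (H : HamiltonianForm n m π) : Prop :=
  ∀ c : FibredChart n m π, ∀ x ∈ r.coordDom c,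
    (∀ (lam : Fin n) (i : Fin m),
      (fderiv ℝ (r.coord c) x (EuclideanSpace.single lam 1)).1.2 i =
        fderiv ℝ (c.ham H.toFun) (r.coord c x) (0, unitArr lam i)) ∧
    ∀ i : Fin m,
      ∑ lam, (fderiv ℝ (r.coord c) x (EuclideanSpace.single lam 1)).2 lam i =
        - fderiv ℝ (c.ham H.toFun) (r.coord c x) ((0, EuclideanSpace.single i 1), 0)

/-- `r` takes values in the Lagrangian constraint space. -/
def LivesIn (N : ∀ y, Set (LegFibre n m π y)) : Prop :=
  ∀ x, (r.toFun x).2 ∈ N (r.toFun x).1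

end LegSection

/-- `Ψ` is a smooth global section of the fibred manifold `J^1 Y → N_L`; only the values of `Ψ` on
`N_L` matter. -/
def IsGlobalSection (L : Lagrangian n m π) (Ψ : ∀ y, LegFibre n m π y → JetFibre n m π y) :
    Prop :=
  (∀ (y : Y), ∀ p ∈ L.constraintSpace y, L.LegendreMap (Ψ y p) p) ∧
  ∀ (c : FibredChart n m π) (k : ℕ) (S : AdaptedChart c L.constraintSpace k),
    ContDiffOn ℝ ∞
      (fun z => c.jetCoord (Ψ (c.total.symm z.1) (c.leg (c.total.symm z.1) (S.mom z)))) S.dom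

namespace AdaptedChart

variable {c : FibredChart n m π} {L : Lagrangian n m π} {k : ℕ}
  (S : AdaptedChart c L.constraintSpace k)

/-- The coordinate expression of a map `Ψ : N_L → J^1 Y` over `Y`. -/
noncomputable def sectionCoord (Ψ : ∀ y, LegFibre n m π y → JetFibre n m π y)
    (z : (Model n × Model m) × Model k) : Coord n m :=
  (z.1, c.jetCoord (Ψ (c.total.symm z.1) (c.leg (c.total.symm z.1) (S.mom z))))

/-- The constrained Hamiltonian form `H_N = Ψ^* H_L` in the coordinates of `N_L`. -/
noncomputable def constrainedForm (Ψ : ∀ y, LegFibre n m π y → JetFibre n m π y) :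
    (Model n × Model m) × Model k →
      ((Model n × Model m) × Model k) [⋀^Fin n]→L[ℝ] ℝ :=
  pullback (S.sectionCoord Ψ) (c.poincareCartan L)

/-- The coordinate expression of a section `r` with values in `N_L`. -/
noncomputable def restrictedCoord (r : LegSection n m π) (x : Model n) :
    (Model n × Model m) × Model k :=
  ((r.coord c x).1, S.ret (r.coord c x))

end AdaptedChart

/-- `r` satisfies the constrained Hamilton equations `r^*(u ⌋ d(Ψ^* H_L)) = 0` for all vertical
tangent vectors `u` of `N_L → X`. -/
def SolvesConstrainedHamilton (L : Lagrangian n m π)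
    (Ψ : ∀ y, LegFibre n m π y → JetFibre n m π y) (r : LegSection n m π) : Prop :=
  ∀ (c : FibredChart n m π) (k : ℕ) (S : AdaptedChart c L.constraintSpace k),
    ∀ x ∈ r.coordDom c, r.coord c x ∈ S.nbhd →
    ∀ u : (Model n × Model m) × Model k, u.1.1 = 0 → ∀ e : Fin n → Model n,
      extDeriv (S.constrainedForm Ψ) (S.restrictedCoord r x)
        (Fin.cons u fun j => fderiv ℝ (S.restrictedCoord r) x (e j)) = 0

end Bundle
end Polysymplectic

/-!
# Hamilton equations on the Lagrangian constraint space

A global section of the Legendre map over the constraint space `N_L` is the restriction of the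
Hamiltonian map `Φ` of `H`: the identity `L̂ ∘ Ĥ ∘ L̂ = L̂` says precisely that `Φ` is a right inverse of
the Legendre map on `N_L`, and `Φ` is smooth because its jet coordinates are `∂𝓗/∂p^λ_i`
(`exists_isGlobalSection`).

For the constrained equations, the point is that `Ψ^* H_L` is the restriction of `H` to `N_L`, for every
global section `Ψ`. In coordinates `H_L = π^λ_i dy^i ∧ ω_λ - (π^λ_i y^i_λ - 𝓛) ω`
(`FibredChart.poincareCartan_eq`), so that `Ψ^* H_L` and `H` differ only through the energy
`π^λ_i y^i_λ - 𝓛` at `Ψ` and the function `𝓗`. The energy is constant on each fibre of the Legendre map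
(`IsAlmostRegular.energy_eq`): its derivative along the jet fibre is `p - π`, zero on the fibre over `p`.
A vanishing derivative at the points of a connected set would not suffice (Whitney's example); here
the fibre is a level set of a submersion, hence locally connected by `C^1` paths
(`eventually_eq_of_hasFDerivAt_zero_on_level`). The energy at `Ψ` is therefore the energy at `Φ`, which is
`𝓗` since `H` is weakly associated with `L` (`AdaptedChart.ham_eq_energy`).

On `N_L` the form `Ψ^* H_L` is thus `P^λ_i dy^i ∧ ω_λ - h ω`, where `P` and `h` are the restrictions of the
momenta and of `𝓗`. Its exterior derivative, contracted with a vertical vector `u` and pulled back along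
a section, is computed by bordered determinants and Cramer's rule (`extDeriv_hamiltonian_cons`). The
coefficient of the volume form is the combination of the Hamilton equations with coefficients the
components of the image of `u` in the Legendre bundle, and it vanishes along a solution.
-/

namespace Polysymplectic

/-! ### Exterior products of covectors and their exterior derivatives -/

section Wedge

variable {n : ℕ} {W : Type*} [NormedAddCommGroup W] [NormedSpace ℝ W]

theorem wedge_apply (α : Fin n → W →L[ℝ] ℝ) (v : Fin n → W) :
    wedge α v = (Matrix.of fun a b => α b (v a)).det := rfl

theorem wedge_comp {W' : Type*} [NormedAddCommGroup W'] [NormedSpace ℝ W']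
    (α : Fin n → W →L[ℝ] ℝ) (g : W' →L[ℝ] W) :
    (wedge α).compContinuousLinearMap g = wedge fun b => (α b).comp g := rfl

/-- The exterior derivative `df ∧ α^0 ∧ ⋯ ∧ α^{n-1}` as a determinant: the alternating sum which defines
it is the expansion along the column of `df`. -/
theorem extDeriv_smul_wedge {f : W → ℝ} {z : W} (hf : DifferentiableAt ℝ f z)
    (α : Fin n → W →L[ℝ] ℝ) (v : Fin (n + 1) → W) :
    extDeriv (fun z => f z • wedge α) z v =
      (Matrix.of fun a b => (Fin.cons (fderiv ℝ f z) α : Fin (n + 1) → W →L[ℝ] ℝ) b (v a)).det := by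
  rw [extDeriv_apply (hf.smul_const _), Matrix.det_succ_column_zero]
  refine Finset.sum_congr rfl fun a _ => ?_
  have h : fderiv ℝ (fun z => (f z • wedge α) (a.removeNth v)) z =
      wedge α (a.removeNth v) • fderiv ℝ f z := by
    simp only [ContinuousAlternatingMap.smul_apply, smul_eq_mul]
    rw [fderiv_mul_const hf]
  rw [h]
  simp only [FunLike.coe_smul, Pi.smul_apply, smul_eq_mul, Matrix.of_apply, Fin.cons_zero]
  rw [mul_assoc, mul_comm (wedge α _), zsmul_eq_mul]
  push_cast
  rfl

/-- The matrix `E` with its column `l` replaced by `b`, bordered on the left by the column `a` and on top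
by a row whose only nonzero entries are `s` in the corner and `t` above `b`. -/
def bordered (E : Matrix (Fin n) (Fin n) ℝ) (l : Fin n) (s t : ℝ) (a b : Fin n → ℝ) :
    Matrix (Fin (n + 1)) (Fin (n + 1)) ℝ :=
  Matrix.of (Fin.cons (Fin.cons s (Pi.single l t))
    fun k => Fin.cons (a k) (Function.update (E k) l (b k)))

theorem det_bordered_left (E : Matrix (Fin n) (Fin n) ℝ) (l : Fin n) (s : ℝ) (a b : Fin n → ℝ) :
    (bordered E l s 0 a b).det = s * (E.updateCol l b).det := by
  rw [Matrix.det_succ_row_zero, Fin.sum_univ_succ, Finset.sum_eq_zero]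
  · have : (bordered E l s 0 a b).submatrix Fin.succ (Fin.succAbove 0) = E.updateCol l b := by
      ext i j
      simp [bordered, Matrix.updateCol_apply, Function.update_apply]
    rw [this]
    simp [bordered, -Fin.cons_update]
  · intro j _
    simp [bordered, -Fin.cons_update]

/-- The row on top splits into the parts of `s` and of `t`; exchanging the columns `a` and `b` reduces the
second part to the first. -/
theorem det_bordered (E : Matrix (Fin n) (Fin n) ℝ) (l : Fin n) (s t : ℝ) (a b : Fin n → ℝ) :
    (bordered E l s t a b).det =
      s * (E.updateCol l b).det - t * (E.updateCol l a).det := by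
  have hadd : bordered E l s t a b = (bordered E l s t a b).updateRow 0
      (Fin.cons s 0 + Fin.cons 0 (Pi.single l t)) := by
    ext i j
    refine Fin.cases ?_ (fun i => ?_) i <;> refine Fin.cases ?_ (fun j => ?_) j <;>
      simp [bordered, -Fin.cons_update]
  have h1 : (bordered E l s t a b).updateRow 0 (Fin.cons s 0) = bordered E l s 0 a b := by
    ext i j
    refine Fin.cases ?_ (fun i => ?_) i <;> refine Fin.cases ?_ (fun j => ?_) j <;>
      simp [bordered, -Fin.cons_update]
  -- Exchanging the columns `0` and `l + 1` exchanges the roles of `a` and `b`.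
  have h2 : (bordered E l s t a b).updateRow 0 (Fin.cons 0 (Pi.single l t)) =
      (bordered E l t 0 b a).submatrix id (Equiv.swap 0 l.succ) := by
    ext i j
    refine Fin.cases ?_ (fun i => ?_) i <;> refine Fin.cases ?_ (fun j => ?_) j
    · simp [bordered, -Fin.cons_update]
    · by_cases hj : j = l
      · subst hj
        simp [bordered, -Fin.cons_update]
      · have : Equiv.swap 0 l.succ j.succ = j.succ :=
          Equiv.swap_apply_of_ne_of_ne (Fin.succ_ne_zero j) (by simpa using hj)
        simp [bordered, -Fin.cons_update, this, hj]
    · simp [bordered, -Fin.cons_update]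
    · by_cases hj : j = l
      · subst hj
        simp [bordered, -Fin.cons_update]
      · have : Equiv.swap 0 l.succ j.succ = j.succ :=
          Equiv.swap_apply_of_ne_of_ne (Fin.succ_ne_zero j) (by simpa using hj)
        simp [bordered, -Fin.cons_update, this, hj]
  rw [hadd, Matrix.det_updateRow_add, h1, h2, Matrix.det_permute', det_bordered_left,
    det_bordered_left, Equiv.Perm.sign_swap (Fin.succ_ne_zero l).symm]
  simp
  ring

/-- Cramer's rule for a replaced column which is a combination of the columns. -/
theorem det_updateCol_mulVec (E : Matrix (Fin n) (Fin n) ℝ) (l : Fin n) (g : Fin n → ℝ) :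
    (E.updateCol l (E.mulVec g)).det = E.det * g l := by
  rw [← Matrix.cramer_apply, Matrix.cramer_eq_adjugate_mulVec, Matrix.mulVec_mulVec,
    Matrix.adjugate_mul, Matrix.smul_mulVec, Matrix.one_mulVec]
  simp

/-- Contraction of `df ∧ β^0 ∧ ⋯ ∧ β^{n-1}` with a vector annihilated by all `β^μ`. -/
theorem extDeriv_smul_wedge_cons {f : W → ℝ} {z : W} (hf : DifferentiableAt ℝ f z)
    (β : Fin n → W →L[ℝ] ℝ) {u : W} (hu : ∀ b, β b u = 0) (T : Fin n → W) :
    extDeriv (fun z => f z • wedge β) z (Fin.cons u T) =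
      (Matrix.of fun a b => β b (T a)).det * fderiv ℝ f z u := by
  rw [extDeriv_smul_wedge hf, Matrix.det_succ_row_zero, Fin.sum_univ_succ, Finset.sum_eq_zero]
  · simp only [Fin.val_zero, pow_zero, one_mul, Matrix.of_apply, Fin.cons_zero, add_zero]
    rw [mul_comm]
    rfl
  · intro j _
    simp [hu]

/-- Contraction of `df ∧ γ ∧ ω_l`, where `ω = β^0 ∧ ⋯ ∧ β^{n-1}`, with a vector annihilated by
all `β^μ`, evaluated on vectors on which `df` and `γ` are the combinations `φ` and `g` of the
`β^μ`. -/
theorem extDeriv_smul_wedge_update_cons {f : W → ℝ} {z : W} (hf : DifferentiableAt ℝ f z)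
    (β : Fin n → W →L[ℝ] ℝ) (γ : W →L[ℝ] ℝ) (l : Fin n) {u : W} (hu : ∀ b, β b u = 0)
    (T : Fin n → W) (φ g : Fin n → ℝ) (hφ : ∀ a, fderiv ℝ f z (T a) = ∑ b, β b (T a) * φ b)
    (hg : ∀ a, γ (T a) = ∑ b, β b (T a) * g b) :
    extDeriv (fun z => f z • wedge (Function.update β l γ)) z (Fin.cons u T) =
      (Matrix.of fun a b => β b (T a)).det * (fderiv ℝ f z u * g l - γ u * φ l) := by
  set E : Matrix (Fin n) (Fin n) ℝ := Matrix.of fun a b => β b (T a) with hE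
  have hM : (Matrix.of fun a b => (Fin.cons (fderiv ℝ f z) (Function.update β l γ) :
      Fin (n + 1) → W →L[ℝ] ℝ) b ((Fin.cons u T : Fin (n + 1) → W) a)) =
      bordered E l (fderiv ℝ f z u) (γ u) (E.mulVec φ) (E.mulVec g) := by
    ext i j
    refine Fin.cases ?_ (fun i => ?_) i <;> refine Fin.cases ?_ (fun j => ?_) j
    · simp [bordered, -Fin.cons_update]
    · by_cases hj : j = l
      · subst hj; simp [bordered, -Fin.cons_update]
      · simp [bordered, -Fin.cons_update, hj, hu]
    · simp [bordered, -Fin.cons_update, hφ, hE, Matrix.mulVec, dotProduct]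
    · by_cases hj : j = l
      · subst hj; simp [bordered, -Fin.cons_update, hg, hE, Matrix.mulVec, dotProduct]
      · simp [bordered, -Fin.cons_update, hj, hE]
  rw [extDeriv_smul_wedge hf, hM, det_bordered, det_updateCol_mulVec, det_updateCol_mulVec]
  ring

end Wedge

/-! ### Functions on the level sets of a submersion -/

/-- A function whose derivative vanishes along a level set of a submersion is locally constant on
this level set: by the implicit function theorem the level set has a local `C^1` parametrization by
a ball in the kernel of the derivative of the submersion. -/
theorem eventually_eq_of_hasFDerivAt_zero_on_level {E G : Type*} [NormedAddCommGroup E]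
    [NormedSpace ℝ E] [CompleteSpace E] [NormedAddCommGroup G] [NormedSpace ℝ G]
    [FiniteDimensional ℝ G] {h : E → G} {g : E → ℝ} {a : E} (hh : ContDiffAt ℝ 1 h a)
    (hsurj : Function.Surjective (fderiv ℝ h a))
    (hg : ∀ᶠ v in 𝓝 a, h v = h a → HasFDerivAt g (0 : E →L[ℝ] ℝ) v) :
    ∀ᶠ v in 𝓝 a, h v = h a → g v = g a := by
  have : CompleteSpace G := FiniteDimensional.complete ℝ G
  have hstrict : HasStrictFDerivAt h (fderiv ℝ h a) a := hh.hasStrictFDerivAt one_ne_zero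
  set D := hstrict.implicitFunctionDataOfComplemented h _ (LinearMap.range_eq_top.2 hsurj)
    (fderiv ℝ h a).ker_closedComplemented_of_finiteDimensional_range
  have hright : ContDiff ℝ 1 D.rightFun := by
    change ContDiff ℝ 1 fun x => Classical.choose
      (fderiv ℝ h a).ker_closedComplemented_of_finiteDimensional_range (x - a)
    exact (ContinuousLinearMap.contDiff _).comp (contDiff_id.sub contDiff_const)
  have hψ : ContDiffAt ℝ 1 D.implicitFunction.uncurry (D.prodFun D.pt) :=
    D.contDiffAt_implicitFunction hh hright.contDiffAt one_ne_zero
  set ψ : _ → E := fun k => D.implicitFunction (h a) k with hψ_def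
  set k₀ := D.rightFun a
  have hψk : ContDiffAt ℝ 1 ψ k₀ :=
    ContDiffAt.comp (g := D.implicitFunction.uncurry) k₀ hψ
      (contDiffAt_const.prodMk contDiffAt_id)
  have hψ₀ : ψ k₀ = a := D.implicitFunction_apply_image.self_of_nhds
  have hlevel : ∀ᶠ k in 𝓝 k₀, h (ψ k) = h a := by
    have hc : Tendsto (fun k => (h a, k)) (𝓝 k₀) (𝓝 (D.prodFun D.pt)) :=
      (Continuous.prodMk_right (h a)).tendsto k₀
    exact hc.eventually D.leftFun_implicitFunction
  have hgψ : ∀ᶠ k in 𝓝 k₀, h (ψ k) = h a → HasFDerivAt g (0 : E →L[ℝ] ℝ) (ψ k) := by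
    have hc : Tendsto ψ (𝓝 k₀) (𝓝 a) := by
      have := hψk.continuousAt.tendsto
      rwa [hψ₀] at this
    exact hc.eventually hg
  have hdiff : ∀ᶠ k in 𝓝 k₀, DifferentiableAt ℝ ψ k :=
    (ContDiffAt.eventually hψk (by simp)).mono fun k hk =>
      ContDiffAt.differentiableAt hk one_ne_zero
  obtain ⟨ε, hε, hball⟩ := Metric.eventually_nhds_iff_ball.1 (hlevel.and (hgψ.and hdiff))
  have hderiv : ∀ k ∈ Metric.ball k₀ ε, HasFDerivAt (g ∘ ψ) (0 : _ →L[ℝ] ℝ) k := by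
    intro k hk
    obtain ⟨h1, h2, h3⟩ := hball k hk
    simpa using (h2 h1).comp k h3.hasFDerivAt
  have hconst : ∀ k ∈ Metric.ball k₀ ε, g (ψ k) = g a := by
    intro k hk
    have := (convex_ball k₀ ε).is_const_of_fderivWithin_eq_zero (f := g ∘ ψ) (𝕜 := ℝ)
      (fun x hx => (hderiv x hx).differentiableAt.differentiableWithinAt)
      (fun x hx => by
        rw [fderivWithin_of_isOpen Metric.isOpen_ball hx, (hderiv x hx).fderiv])
      hk (Metric.mem_ball_self hε)
    simpa [hψ₀] using this
  have hnear : ∀ᶠ v in 𝓝 a, D.rightFun v ∈ Metric.ball k₀ ε :=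
    hright.continuous.continuousAt.eventually (Metric.ball_mem_nhds k₀ hε)
  filter_upwards [hnear, D.implicitFunction_apply_image] with v hv hinv hl
  have : ψ (D.rightFun v) = v := by
    rw [← hl] at hψ_def
    rw [hψ_def]
    exact hinv
  rw [← this]
  exact hconst _ hv

theorem eq_of_isPreconnected_of_eventually_eq {α β : Type*} [TopologicalSpace α] {s : Set α}
    (hs : IsPreconnected s) {g : α → β} (hg : ∀ x ∈ s, ∀ᶠ y in 𝓝[s] x, g y = g x)
    {x y : α} (hx : x ∈ s) (hy : y ∈ s) : g x = g y := by
  have : PreconnectedSpace s := isPreconnected_iff_preconnectedSpace.1 hs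
  have hloc : IsLocallyConstant fun z : s => g z := by
    rw [IsLocallyConstant.iff_eventually_eq]
    intro z
    exact (map_nhds_subtype_val z ▸ hg z z.2 : ∀ᶠ y in map Subtype.val (𝓝 z), g y = g z)
  exact hloc.apply_eq_of_isPreconnected isPreconnected_univ (x := ⟨x, hx⟩) (y := ⟨y, hy⟩)
    trivial trivial

/-! ### Coordinates of jets and momenta in a fibred chart -/

section Arrays

variable {n m : ℕ}

theorem velMap_apply (v : Arr n m) (u : Model n) (i : Fin m) :
    velMap v u i = ∑ lam, u lam * v lam i := by
  simp [velMap]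

theorem velMap_single (v : Arr n m) (lam : Fin n) :
    velMap v (EuclideanSpace.single lam 1) = WithLp.toLp 2 (v lam) := by
  ext i
  simp [velMap_apply]

theorem velMap_add (v w : Arr n m) : velMap (v + w) = velMap v + velMap w := by
  ext u i
  simp [velMap_apply, mul_add, Finset.sum_add_distrib]

theorem velMap_smul (t : ℝ) (v : Arr n m) : velMap (t • v) = t • velMap v := by
  ext u i
  simp [velMap_apply, Finset.mul_sum, mul_left_comm]

theorem arr_eq_sum (v : Arr n m) : v = ∑ lam, ∑ i, v lam i • unitArr lam i := by
  ext a b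
  simp only [Finset.sum_apply, Pi.smul_apply, smul_eq_mul, unitArr]
  rw [Finset.sum_eq_single a, Finset.sum_eq_single b]
  · simp
  · intro i _ hi
    simp [hi.symm]
  · simp
  · intro l _ hl
    simp [Pi.single_eq_of_ne hl.symm]
  · simp

theorem sum_mul_unitArr (p : Arr n m) (lam : Fin n) (i : Fin m) :
    ∑ l, ∑ j, p l j * (unitArr lam i : Arr n m) l j = p lam i := by
  rw [Finset.sum_eq_single lam, Finset.sum_eq_single i]
  · simp [unitArr]
  · intro j _ hj
    simp [unitArr, hj]
  · simp
  · intro l _ hl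
    simp [unitArr, hl]
  · simp

theorem model_eq_sum (u : Model n) : u = ∑ lam, u lam • EuclideanSpace.single lam (1 : ℝ) := by
  ext a
  simp [Finset.sum_apply, Pi.single_apply]

end Arrays

namespace FibredChart

variable {n m : ℕ} {X Y : Type*}
  [TopologicalSpace X] [ChartedSpace (Model n) X]
  [TopologicalSpace Y] [ChartedSpace (Model n × Model m) Y]
  {π : Y → X} (c : FibredChart n m π)

theorem dX_partialX {x : X} (hx : x ∈ c.base.source) (lam : Fin n) :
    c.dX x (c.partialX x lam) = EuclideanSpace.single lam 1 :=
  (c.isInvertible_dX hx).self_apply_inverse _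

theorem eq_sum_partialX {x : X} (hx : x ∈ c.base.source) (u : TX n x) :
    u = ∑ lam, (c.dX x u : Model n) lam • c.partialX x lam := by
  apply (c.isInvertible_dX hx).injective
  rw [map_sum]
  simp only [map_smul, c.dX_partialX hx]
  exact model_eq_sum _

theorem vol_partialX {x : X} (hx : x ∈ c.base.source) : c.vol x (c.partialX x) = 1 := by
  change (Matrix.of fun a b => (c.dX x (c.partialX x a) : Model n) b).det = 1
  simp only [c.dX_partialX hx]
  rw [← Matrix.det_one (n := Fin n) (R := ℝ)]
  congr 1
  ext i j
  simp [Matrix.one_apply, eq_comm]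

/-- A density is determined by its value on the coordinate vectors. -/
theorem density_apply {x : X} (hx : x ∈ c.base.source) (α : Density n x) (u : Fin n → TX n x) :
    α u = α (c.partialX x) * c.vol x u := by
  obtain ⟨e, he⟩ := c.isInvertible_dX hx
  let b : Module.Basis (Fin n) ℝ (TX n x) :=
    (EuclideanSpace.basisFun (Fin n) ℝ).toBasis.map e.symm.toLinearEquiv
  have hb : ⇑b = c.partialX x := by
    ext1 lam
    apply (c.isInvertible_dX hx).injective
    rw [c.dX_partialX hx, ← he]
    simp [b]
  have h1 : α u = α b * b.det u := congrArg (fun f => f u) (α.toAlternatingMap.eq_smul_basis_det b)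
  have h2 : c.vol x u = c.vol x b * b.det u :=
    congrArg (fun f => f u) ((c.vol x).toAlternatingMap.eq_smul_basis_det b)
  rw [h1, h2, hb, c.vol_partialX hx, one_mul]

theorem dY_vert {y : Y} (hy : y ∈ c.total.source) (v : Arr n m) (u : TX n (π y)) :
    c.dY y ((c.vert y hy v).1 u) = (0, velMap v (c.dX (π y) u)) :=
  (c.isInvertible_dY hy).self_apply_inverse _

theorem dY_jet {y : Y} (hy : y ∈ c.total.source) (v : Arr n m) (u : TX n (π y)) :
    c.dY y ((c.jet y hy v).1 u) = (c.dX (π y) u, velMap v (c.dX (π y) u)) :=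
  (c.isInvertible_dY hy).self_apply_inverse _

/-- A linear map into the tangent space of `Y` has the fibre components given by its values on the
coordinate vectors. -/
theorem snd_dY_apply {y : Y} (hy : y ∈ c.total.source) (B : TX n (π y) →L[ℝ] TY n m y)
    (u : TX n (π y)) :
    (c.dY y (B u)).2 =
      velMap (fun lam i => (c.dY y (B (c.partialX (π y) lam))).2 i) (c.dX (π y) u) := by
  ext i
  rw [velMap_apply]
  conv_lhs => rw [c.eq_sum_partialX (c.proj_mem y hy) u]
  rw [map_sum, map_sum, Prod.snd_sum]
  simp

theorem jet_jetCoord {y : Y} (hy : y ∈ c.total.source) (A : JetFibre n m π y) :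
    c.jet y hy (c.jetCoord A) = A := by
  apply Subtype.ext
  ext1 u
  apply (c.isInvertible_dY hy).injective
  rw [c.dY_jet hy]
  refine Prod.ext ?_ (c.snd_dY_apply hy A.1 u).symm
  rw [← c.dX_dProj hy, A.2]

theorem vert_coord {y : Y} (hy : y ∈ c.total.source) (φ : VertHom n m π y) :
    c.vert y hy (fun lam i => (c.dY y (φ.1 (c.partialX (π y) lam))).2 i) = φ := by
  apply Subtype.ext
  ext1 u
  apply (c.isInvertible_dY hy).injective
  rw [c.dY_vert hy]
  refine Prod.ext ?_ (c.snd_dY_apply hy φ.1 u).symm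
  have h : dProj n m π y (φ.1 u) = 0 := φ.2 u
  rw [← c.dX_dProj hy, h, map_zero]

theorem translate_jet {y : Y} (hy : y ∈ c.total.source) (v w : Arr n m) (t : ℝ) :
    JetFibre.translate n m (c.jet y hy v) (t • c.vert y hy w) = c.jet y hy (v + t • w) := by
  apply Subtype.ext
  ext1 u
  apply (c.isInvertible_dY hy).injective
  have h : (JetFibre.translate n m (c.jet y hy v) (t • c.vert y hy w)).1 u =
    (c.jet y hy v).1 u + t • (c.vert y hy w).1 u := rfl
  rw [h, map_add, map_smul, c.dY_jet hy, c.dY_jet hy, c.dY_vert hy, velMap_add, velMap_smul]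
  simp

theorem leg_vert {y : Y} (hy : y ∈ c.total.source) (p v : Arr n m) :
    c.leg y p (c.vert y hy v) = (∑ lam, ∑ i, p lam i * v lam i) • c.vol (π y) := by
  simp [leg, c.dY_vert hy, c.dX_partialX (c.proj_mem y hy), velMap_single]

theorem momCoord_leg {y : Y} (hy : y ∈ c.total.source) (p : Arr n m) :
    c.momCoord (c.leg y p) = p := by
  ext lam i
  rw [momCoord, dif_pos hy, c.leg_vert hy, sum_mul_unitArr]
  simp [c.vol_partialX (c.proj_mem y hy)]

theorem legCoord_leg {y : Y} (hy : y ∈ c.total.source) (p : Arr n m) :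
    c.legCoord (c.leg y p) = (c.total y, p) := by
  rw [legCoord, c.momCoord_leg hy]

theorem isOpen_target_prod : IsOpen (c.total.target ×ˢ (univ : Set (Arr n m))) :=
  c.total.open_target.prod isOpen_univ

theorem lagr_total (L : ∀ y, JetFibre n m π y → Density n (π y)) {y : Y}
    (hy : y ∈ c.total.source) (v : Arr n m) :
    c.lagr L (c.total y, v) = L y (c.jet y hy v) (c.partialX (π y)) := by
  have key : ∀ (y' : Y) (hy' : y' ∈ c.total.source), y' = y →
      L y' (c.jet y' hy' v) (c.partialX (π y')) = L y (c.jet y hy v) (c.partialX (π y)) := by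
    rintro y' hy' rfl
    rfl
  rw [lagr, dif_pos (c.total.map_source hy)]
  exact key _ _ (c.total.left_inv hy)

end FibredChart

/-! ### The Legendre map in coordinates -/

section Legendre

variable {n m : ℕ} {X Y : Type*}
  [TopologicalSpace X] [ChartedSpace (Model n) X]
  [TopologicalSpace Y] [ChartedSpace (Model n × Model m) Y]
  {π : Y → X} (c : FibredChart n m π) (L : Lagrangian n m π)

namespace FibredChart

theorem contDiffAt_lagr {w : Coord n m} (hw : w.1 ∈ c.total.target) :
    ContDiffAt ℝ ∞ (c.lagr L.toFun) w :=
  (L.smooth c).contDiffAt (c.isOpen_target_prod.mem_nhds ⟨hw, trivial⟩)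

theorem contDiffAt_ham (H : HamiltonianForm n m π) {w : Coord n m} (hw : w.1 ∈ c.total.target) :
    ContDiffAt ℝ ∞ (c.ham H.toFun) w :=
  (H.smooth c).contDiffAt (c.isOpen_target_prod.mem_nhds ⟨hw, trivial⟩)

theorem contDiffAt_momenta {w : Coord n m} (hw : w.1 ∈ c.total.target) :
    ContDiffAt ℝ ∞ (c.momenta L) w := by
  refine contDiffAt_pi.2 fun lam => contDiffAt_pi.2 fun i => ?_
  exact ((c.contDiffAt_lagr L hw).fderiv_right (m := ∞) (by simp)).clm_apply contDiffAt_const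

theorem contDiffAt_legendre {w : Coord n m} (hw : w.1 ∈ c.total.target) :
    ContDiffAt ℝ ∞ (c.legendre L) w :=
  contDiffAt_fst.prodMk (c.contDiffAt_momenta L hw)

theorem fderiv_lagr_vertical (w : Coord n m) (v : Arr n m) :
    fderiv ℝ (c.lagr L.toFun) w (0, v) = ∑ lam, ∑ i, c.momenta L w lam i * v lam i := by
  have h : ((0, v) : Coord n m) = ContinuousLinearMap.inr ℝ (Model n × Model m) (Arr n m) v := rfl
  rw [h]
  conv_lhs => rw [arr_eq_sum v]
  simp only [map_sum, map_smul, smul_eq_mul, momenta, ContinuousLinearMap.inr_apply, mul_comm]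

theorem hasDerivAt_lagr_line {z : Model n × Model m} (hz : z ∈ c.total.target) (v w : Arr n m) :
    HasDerivAt (fun t : ℝ => c.lagr L.toFun (z, v + t • w))
      (∑ lam, ∑ i, c.momenta L (z, v) lam i * w lam i) 0 := by
  have h1 : HasDerivAt (fun t : ℝ => ((z, v + t • w) : Coord n m)) (0, w) 0 := by
    refine (hasDerivAt_const (0 : ℝ) z).prodMk ?_
    simpa using ((hasDerivAt_id (0 : ℝ)).smul_const w).const_add v
  have h2 : HasFDerivAt (c.lagr L.toFun) (fderiv ℝ (c.lagr L.toFun) (z, v))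
      ((z, v + (0 : ℝ) • w) : Coord n m) := by
    simpa using ((c.contDiffAt_lagr L (w := (z, v)) hz).differentiableAt (by simp)).hasFDerivAt
  have h3 := h2.comp_hasDerivAt (0 : ℝ) h1
  rwa [c.fderiv_lagr_vertical] at h3

variable {c L}

/-- The momentum coordinates of the image of a jet under the Legendre map are the `π^λ_i`. -/
theorem momCoord_eq_momenta {y : Y} (hy : y ∈ c.total.source) {A : JetFibre n m π y}
    {p : LegFibre n m π y} (h : L.LegendreMap A p) :
    c.momCoord p = c.momenta L (c.total y, c.jetCoord A) := by
  ext lam i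
  have h1 := h (c.vert y hy (unitArr lam i)) (c.partialX (π y))
  have h2 := c.hasDerivAt_lagr_line L (c.total.map_source hy) (c.jetCoord A) (unitArr lam i)
  rw [sum_mul_unitArr] at h2
  simp only [c.lagr_total L.toFun hy, ← c.translate_jet hy, c.jet_jetCoord hy] at h2
  rw [momCoord, dif_pos hy]
  exact h1.unique h2

theorem legendreMap_jet {y : Y} (hy : y ∈ c.total.source) (v : Arr n m) :
    L.LegendreMap (c.jet y hy v) (c.leg y (c.momenta L (c.total y, v))) := by
  intro φ u
  rw [← c.vert_coord hy φ]
  set w : Arr n m := fun lam i => (c.dY y (φ.1 (c.partialX (π y) lam))).2 i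
  have h := (c.hasDerivAt_lagr_line L (c.total.map_source hy) v w).mul_const (c.vol (π y) u)
  rw [c.leg_vert hy]
  refine h.congr_of_eventuallyEq (Eventually.of_forall fun t => ?_)
  simp only [c.translate_jet hy, c.lagr_total L.toFun hy]
  exact c.density_apply (c.proj_mem y hy) _ u

theorem leg_momenta_mem {y : Y} (hy : y ∈ c.total.source) (v : Arr n m) :
    c.leg y (c.momenta L (c.total y, v)) ∈ L.constraintSpace y :=
  ⟨_, legendreMap_jet hy v⟩

end FibredChart

/-! ### The energy function on the fibres of the Legendre map -/

variable {L}

/-- The energy `p^λ_i y^i_λ - 𝓛` is constant on the fibres of the Legendre map: its derivative along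
the jet fibre is `p - ∂𝓛/∂y^i_λ`, which vanishes on the fibre over `p`, and this fibre is a connected
level set of a submersion. -/
theorem IsAlmostRegular.energy_eq (hL : IsAlmostRegular L) (c : FibredChart n m π) {y : Y}
    (hy : y ∈ c.total.source) {p : LegFibre n m π y} {A A' : JetFibre n m π y}
    (hA : L.LegendreMap A p) (hA' : L.LegendreMap A' p) :
    (∑ lam, ∑ i, c.momCoord p lam i * c.jetCoord A lam i) -
        c.lagr L.toFun (c.total y, c.jetCoord A) =
      (∑ lam, ∑ i, c.momCoord p lam i * c.jetCoord A' lam i) -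
        c.lagr L.toFun (c.total y, c.jetCoord A') := by
  have hp : p ∈ L.constraintSpace y := ⟨A, hA⟩
  have hyt := c.total.map_source hy
  obtain ⟨k, hcov, -⟩ := hL.subbundle.2
  obtain ⟨S, hS⟩ := hcov c y hy p hp
  set g : Arr n m → ℝ := fun v =>
    (∑ lam, ∑ i, c.momCoord p lam i * v lam i) - c.lagr L.toFun (c.total y, v)
  set s : Set (Arr n m) := c.jetCoord '' {A | L.LegendreMap A p}
  have hcont : Continuous fun A : JetFibre n m π y => c.jetCoord A := by
    refine continuous_pi fun lam => continuous_pi fun i => ?_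
    have h1 : Continuous fun A : JetFibre n m π y => A.1 (c.partialX (π y) lam) :=
      (continuous_eval_const (c.partialX (π y) lam)).comp continuous_subtype_val
    exact (EuclideanSpace.proj (𝕜 := ℝ) i).continuous.comp
      (continuous_snd.comp ((c.dY y).continuous.comp h1))
  have hconn : IsPreconnected s :=
    (hL.connected y p hp).isPreconnected.image _ hcont.continuousOn
  refine eq_of_isPreconnected_of_eventually_eq hconn (g := g) ?_
    (mem_image_of_mem _ hA) (mem_image_of_mem _ hA')
  have hmom : ∀ v ∈ s, c.momenta L (c.total y, v) = c.momCoord p := by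
    rintro _ ⟨B, hB, rfl⟩
    exact (FibredChart.momCoord_eq_momenta hy hB).symm
  intro v₀ hv₀
  set w₀ : Coord n m := (c.total y, v₀)
  have hleg₀ : c.legendre L w₀ = c.legCoord p := Prod.ext rfl (hmom v₀ hv₀)
  set h : Arr n m → Model k := fun v => S.ret (c.legendre L (c.total y, v))
  have hline : ContDiffAt ℝ ∞ (fun v : Arr n m => ((c.total y, v) : Coord n m)) v₀ :=
    contDiffAt_const.prodMk contDiffAt_id
  have hret : ContDiffAt ℝ ∞ (fun w => S.ret (c.legendre L w)) w₀ := by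
    refine ContDiffAt.comp (g := S.ret) w₀ ?_ (c.contDiffAt_legendre L hyt)
    rw [hleg₀]
    exact S.smooth_ret.contDiffAt (S.isOpen_nbhd.mem_nhds hS)
  have hhsm : ContDiffAt ℝ ∞ h v₀ := ContDiffAt.comp (g := fun w => S.ret (c.legendre L w)) v₀ hret hline
  have hsurj : Function.Surjective (fderiv ℝ h v₀) := by
    intro κ
    obtain ⟨⟨a, b⟩, hab⟩ :=
      hL.submersion c k S w₀ hyt (hleg₀ ▸ hS) ((0 : Model n × Model m), κ)
    rw [DifferentiableAt.fderiv_prodMk differentiableAt_fst (hret.differentiableAt (by simp))] at hab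
    have ha : a = 0 := by
      have := congrArg Prod.fst hab
      simpa [fderiv_fst] using this
    have hb : fderiv ℝ (fun w => S.ret (c.legendre L w)) w₀ (a, b) = κ := congrArg Prod.snd hab
    have hchain : HasFDerivAt h ((fderiv ℝ (fun w => S.ret (c.legendre L w)) w₀).comp
        (ContinuousLinearMap.inr ℝ (Model n × Model m) (Arr n m))) v₀ :=
      (hret.differentiableAt (by simp)).hasFDerivAt.comp v₀ (hasFDerivAt_prodMk_right _ v₀)
    refine ⟨b, ?_⟩
    rw [hchain.fderiv, ← hb, ha]
    rfl
  -- Near `v₀` the level set of `h` consists of jets which the Legendre map sends to `p`.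
  have hlevel : ∀ᶠ v in 𝓝 v₀, h v = h v₀ → c.momenta L (c.total y, v) = c.momCoord p := by
    have hc : ContinuousAt (fun v => c.legendre L (c.total y, v)) v₀ :=
      ContinuousAt.comp (g := c.legendre L) (c.contDiffAt_legendre L hyt).continuousAt
        hline.continuousAt
    have hn : ∀ᶠ v in 𝓝 v₀, c.legendre L (c.total y, v) ∈ S.nbhd :=
      hc.eventually (S.isOpen_nbhd.mem_nhds (by
        change c.legendre L w₀ ∈ S.nbhd
        exact hleg₀ ▸ hS))
    filter_upwards [hn] with v hv heq
    have h1 := S.mom_ret y hy _ (FibredChart.leg_momenta_mem (L := L) hy v)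
    rw [c.legCoord_leg hy, c.momCoord_leg hy] at h1
    have h2 := S.mom_ret y hy p hp hS
    rw [← h1 hv, ← h2, ← hleg₀]
    exact congrArg (fun κ => S.mom (c.total y, κ)) heq
  have hderiv : ∀ᶠ v in 𝓝 v₀, h v = h v₀ → HasFDerivAt g (0 : Arr n m →L[ℝ] ℝ) v := by
    filter_upwards [hlevel] with v hv heq
    have hlin : HasFDerivAt (fun v : Arr n m => ∑ lam, ∑ i, c.momCoord p lam i * v lam i)
        (∑ lam, ∑ i, c.momCoord p lam i •
          ((ContinuousLinearMap.proj i : (Fin m → ℝ) →L[ℝ] ℝ).comp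
            (ContinuousLinearMap.proj lam : Arr n m →L[ℝ] (Fin m → ℝ))))
        v := by
      refine HasFDerivAt.fun_sum fun lam _ => HasFDerivAt.fun_sum fun i _ => ?_
      exact (((ContinuousLinearMap.proj i : (Fin m → ℝ) →L[ℝ] ℝ).comp
        (ContinuousLinearMap.proj lam : Arr n m →L[ℝ] (Fin m → ℝ))).hasFDerivAt).const_mul _
    have hlagr := ((c.contDiffAt_lagr L (w := (c.total y, v)) hyt).differentiableAt
      (by simp)).hasFDerivAt.comp v (hasFDerivAt_prodMk_right _ v)
    refine (hlin.sub hlagr).congr_fderiv ?_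
    ext1 u
    have := c.fderiv_lagr_vertical L (c.total y, v) u
    simp [this, hv heq]
  have hconst := eventually_eq_of_hasFDerivAt_zero_on_level (hhsm.of_le (by simp)) hsurj hderiv
  filter_upwards [eventually_nhdsWithin_of_eventually_nhds hconst, self_mem_nhdsWithin] with v hv hvs
  refine hv ?_
  change S.ret (c.total y, c.momenta L (c.total y, v)) =
    S.ret (c.total y, c.momenta L (c.total y, v₀))
  rw [hmom v hvs, hmom v₀ hv₀]

end Legendre

/-! ### Forms spanned by `ω` and `dy^i ∧ ω_λ` -/

section Covectors

variable {n m : ℕ} {V : Type*} [NormedAddCommGroup V] [NormedSpace ℝ V]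

/-- The covector `dx^λ` on a space with coordinates `((x, y), v)`. -/
noncomputable def baseCovector (lam : Fin n) : (Model n × Model m) × V →L[ℝ] ℝ :=
  (EuclideanSpace.proj lam : Model n →L[ℝ] ℝ).comp
    ((ContinuousLinearMap.fst ℝ (Model n) (Model m)).comp
      (ContinuousLinearMap.fst ℝ (Model n × Model m) V))

/-- The covector `dy^i` on a space with coordinates `((x, y), v)`. -/
noncomputable def fibreCovector (i : Fin m) : (Model n × Model m) × V →L[ℝ] ℝ :=
  (EuclideanSpace.proj i : Model m →L[ℝ] ℝ).comp
    ((ContinuousLinearMap.snd ℝ (Model n) (Model m)).comp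
      (ContinuousLinearMap.fst ℝ (Model n × Model m) V))

/-- Replacing the factor `β^l` of `β^0 ∧ ⋯ ∧ β^{n-1}` by `γ - g_μ β^μ`: only the term `g_l β^l` of the
sum survives in the product. -/
theorem wedge_update_sub_sum {W : Type*} [NormedAddCommGroup W] [NormedSpace ℝ W]
    (β : Fin n → W →L[ℝ] ℝ) (l : Fin n) (γ : W →L[ℝ] ℝ) (g : Fin n → ℝ) :
    wedge (Function.update β l (γ - ∑ mu, g mu • β mu)) =
      wedge (Function.update β l γ) - g l • wedge β := by
  ext v
  set E : Matrix (Fin n) (Fin n) ℝ := Matrix.of fun a b => β b (v a) with hE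
  have hupd : ∀ δ : W →L[ℝ] ℝ,
      wedge (Function.update β l δ) v = (E.updateCol l fun a => δ (v a)).det := by
    intro δ
    rw [wedge_apply]
    congr 1
    ext a b
    by_cases hb : b = l
    · subst hb; simp
    · simp [hb, hE]
  have hcol : (fun a => (γ - ∑ mu, g mu • β mu) (v a)) = (fun a => γ (v a)) - E.mulVec g := by
    ext a
    simp [hE, Matrix.mulVec, dotProduct, mul_comm]
  rw [ContinuousAlternatingMap.sub_apply, ContinuousAlternatingMap.smul_apply, hupd, hupd, hcol,
    ← Matrix.cramer_apply, map_sub, Pi.sub_apply, Matrix.cramer_apply, Matrix.cramer_apply,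
    det_updateCol_mulVec, wedge_apply, smul_eq_mul, mul_comm]

theorem exists_volForm_eq_one (n m : ℕ) : ∃ v, volForm n m v = 1 := by
  refine ⟨fun a => ((EuclideanSpace.single a 1, 0), 0), ?_⟩
  rw [volForm, wedge_apply, ← Matrix.det_one (n := Fin n) (R := ℝ)]
  congr 1
  ext i j
  simp [dxForm, Matrix.one_apply, eq_comm]

theorem extDeriv_fun_sum {W ι : Type*} [NormedAddCommGroup W] [NormedSpace ℝ W]
    (s : Finset ι) {η : ι → W → W [⋀^Fin n]→L[ℝ] ℝ} {z : W}
    (h : ∀ i ∈ s, DifferentiableAt ℝ (η i) z) :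
    extDeriv (fun z => ∑ i ∈ s, η i z) z = ∑ i ∈ s, extDeriv (η i) z := by
  classical
  induction s using Finset.induction_on with
  | empty =>
    ext v
    simp [extDeriv, ContinuousAlternatingMap.alternatizeUncurryFin_apply]
  | insert a s ha ih =>
    simp only [Finset.sum_insert ha]
    rw [extDeriv_fun_add (h a (Finset.mem_insert_self a s))
      (DifferentiableAt.fun_sum fun i hi => h i (Finset.mem_insert_of_mem hi)),
      ih fun i hi => h i (Finset.mem_insert_of_mem hi)]

/-- The exterior derivative of `P^λ_i dy^i ∧ ω_λ - h ω`, contracted with a vertical vector and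
evaluated on the tangent vectors `Q (e j)` of a section over the base. -/
theorem extDeriv_hamiltonian_cons {P : (Model n × Model m) × V → Arr n m}
    {h : (Model n × Model m) × V → ℝ} {z : (Model n × Model m) × V}
    {D : (Model n × Model m) × V →L[ℝ] Arr n m} {K : (Model n × Model m) × V →L[ℝ] ℝ}
    (hP : HasFDerivAt P D z) (hh : HasFDerivAt h K z) {u : (Model n × Model m) × V}
    (hu : u.1.1 = 0) {Q : Model n →L[ℝ] (Model n × Model m) × V} (hQ : ∀ v, (Q v).1.1 = v)
    (e : Fin n → Model n) :
    extDeriv (fun z => (∑ lam, ∑ i, P z lam i •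
        wedge (Function.update (fun mu => baseCovector mu) lam (fibreCovector i))) +
      (-h z) • wedge (fun mu => baseCovector mu)) z (Fin.cons u fun j => Q (e j)) =
    (Matrix.of fun a b => e a b).det *
      ((∑ lam, ∑ i, D u lam i * (Q (EuclideanSpace.single lam 1)).1.2 i) -
        (∑ i, u.1.2 i * ∑ lam, D (Q (EuclideanSpace.single lam 1)) lam i) - K u) := by
  have hPd : ∀ lam i, HasFDerivAt (fun z => P z lam i)
      ((ContinuousLinearMap.proj i : (Fin m → ℝ) →L[ℝ] ℝ).comp
        ((ContinuousLinearMap.proj lam : Arr n m →L[ℝ] (Fin m → ℝ)).comp D)) z := fun lam i =>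
    hasFDerivAt_pi'.1 (hasFDerivAt_pi'.1 hP lam) i
  have hdsum : ∀ lam i, DifferentiableAt ℝ (fun z => P z lam i •
      wedge (Function.update (fun mu => baseCovector mu) lam
        (fibreCovector i : (Model n × Model m) × V →L[ℝ] ℝ))) z := fun lam i =>
    (hPd lam i).differentiableAt.smul_const _
  have hneg : HasFDerivAt (fun z => -h z) (-K) z := hh.neg
  rw [extDeriv_fun_add
    (DifferentiableAt.fun_sum fun lam _ => DifferentiableAt.fun_sum fun i _ => hdsum lam i)
    (hneg.differentiableAt.smul_const _),
    extDeriv_fun_sum _ (fun lam _ => DifferentiableAt.fun_sum fun i _ => hdsum lam i)]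
  simp only [extDeriv_fun_sum _ (fun i _ => hdsum _ i), ContinuousAlternatingMap.add_apply,
    ContinuousAlternatingMap.sum_apply]
  have hu0 : ∀ b : Fin n, (baseCovector b : (Model n × Model m) × V →L[ℝ] ℝ) u = 0 :=
    fun b => by simp [baseCovector, hu]
  have hbase : ∀ a b, (baseCovector b : (Model n × Model m) × V →L[ℝ] ℝ) (Q (e a)) = e a b :=
    fun a b => by simp [baseCovector, hQ]
  have hcomb : ∀ (l : Model n →L[ℝ] ℝ) (a : Fin n), l (e a) =
      ∑ b, (baseCovector b : (Model n × Model m) × V →L[ℝ] ℝ) (Q (e a)) *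
        l (EuclideanSpace.single b 1) := by
    intro l a
    conv_lhs => rw [model_eq_sum (e a)]
    simp only [map_sum, map_smul, smul_eq_mul, hbase]
  have hterm : ∀ lam i, extDeriv (fun z => P z lam i •
      wedge (Function.update (fun mu => baseCovector mu) lam
        (fibreCovector i : (Model n × Model m) × V →L[ℝ] ℝ))) z (Fin.cons u fun j => Q (e j)) =
      (Matrix.of fun a b => e a b).det *
        (D u lam i * (Q (EuclideanSpace.single lam 1)).1.2 i -
          u.1.2 i * D (Q (EuclideanSpace.single lam 1)) lam i) := by
    intro lam i
    rw [extDeriv_smul_wedge_update_cons (hPd lam i).differentiableAt _ _ _ hu0 _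
      (fun b => D (Q (EuclideanSpace.single b 1)) lam i)
      (fun b => (Q (EuclideanSpace.single b 1)).1.2 i), (hPd lam i).fderiv]
    · simp only [hbase]
      rfl
    · intro a
      rw [(hPd lam i).fderiv]
      exact hcomb ((ContinuousLinearMap.proj i : (Fin m → ℝ) →L[ℝ] ℝ).comp
        ((ContinuousLinearMap.proj lam : Arr n m →L[ℝ] (Fin m → ℝ)).comp (D.comp Q))) a
    · intro a
      exact hcomb ((fibreCovector i : (Model n × Model m) × V →L[ℝ] ℝ).comp Q) a
  have hlast : extDeriv (fun z => (-h z) •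
      wedge (fun mu => (baseCovector mu : (Model n × Model m) × V →L[ℝ] ℝ))) z
      (Fin.cons u fun j => Q (e j)) = (Matrix.of fun a b => e a b).det * -K u := by
    rw [extDeriv_smul_wedge_cons hneg.differentiableAt _ hu0, hneg.fderiv]
    simp only [hbase]
    rfl
  simp only [hterm]
  rw [hlast]
  simp only [← Finset.mul_sum, Finset.sum_sub_distrib]
  rw [Finset.sum_comm (f := fun lam i => u.1.2 i * D (Q (EuclideanSpace.single lam 1)) lam i)]
  simp only [← Finset.mul_sum]
  ring

end Covectors

/-! ### The constrained Hamiltonian form -/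

section Constrained

variable {n m : ℕ} {X Y : Type*}
  [TopologicalSpace X] [ChartedSpace (Model n) X]
  [TopologicalSpace Y] [ChartedSpace (Model n × Model m) Y]
  {π : Y → X} {c : FibredChart n m π} {L : Lagrangian n m π} {H : HamiltonianForm n m π}

/-- The Poincaré–Cartan form with its contact forms expanded; the coefficient of `-ω` is the
energy. -/
theorem FibredChart.poincareCartan_eq (w : Coord n m) :
    c.poincareCartan L w =
      (∑ lam, ∑ i, c.momenta L w lam i • wedgeOmega (dyForm i) lam) -
        ((∑ lam, ∑ i, c.momenta L w lam i * w.2 lam i) - c.lagr L.toFun w) • volForm n m := by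
  have h : ∀ lam i, wedgeOmega (FibredChart.contactForm w.2 i) lam =
      wedgeOmega (dyForm i) lam - w.2 lam i • volForm n m := fun lam i =>
    wedge_update_sub_sum (fun mu => dxForm mu) lam (dyForm i) (fun mu => w.2 mu i)
  ext v
  simp only [FibredChart.poincareCartan, h, ContinuousAlternatingMap.add_apply,
    ContinuousAlternatingMap.sub_apply, ContinuousAlternatingMap.smul_apply,
    ContinuousAlternatingMap.sum_apply, smul_eq_mul, mul_sub, Finset.sum_sub_distrib, sub_mul,
    Finset.sum_mul, mul_assoc]
  ring

namespace AdaptedChart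

variable {k : ℕ} (S : AdaptedChart c L.constraintSpace k)
  {Ψ : ∀ y, LegFibre n m π y → JetFibre n m π y}

/-- At the points of the constraint space, the Hamiltonian function is the energy of every jet
which the Legendre map sends to the point. -/
theorem ham_eq_energy (hL : IsAlmostRegular L) (hH : WeaklyAssociated H L) {y : Y}
    (hy : y ∈ c.total.source) {p : LegFibre n m π y} {A : JetFibre n m π y}
    (hA : L.LegendreMap A p) :
    c.ham H.toFun (c.legCoord p) = (∑ lam, ∑ i, c.momCoord p lam i * c.jetCoord A lam i) -
      c.lagr L.toFun (c.total y, c.jetCoord A) := by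
  obtain ⟨Φ, -, hΦ, hform⟩ := hH
  rw [hL.energy_eq c hy hA (hΦ y A p hA)]
  have h := hform c y hy p ⟨A, hA⟩
  obtain ⟨v, hv⟩ := exists_volForm_eq_one n m
  have hv' := congrArg (fun F => F v) h
  simp only [FibredChart.hamForm, FibredChart.mapForm, FibredChart.legCoord,
    ContinuousAlternatingMap.add_apply, ContinuousAlternatingMap.sub_apply,
    ContinuousAlternatingMap.smul_apply, hv, smul_eq_mul, mul_one] at hv'
  rw [FibredChart.legCoord]
  linarith

/-- The pull-back `Ψ^* H_L` is the restriction of the Hamiltonian form to the constraint space. -/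
theorem poincareCartan_sectionCoord (hL : IsAlmostRegular L) (hH : WeaklyAssociated H L)
    (hΨ : IsGlobalSection L Ψ) {z : (Model n × Model m) × Model k} (hz : z ∈ S.dom) :
    c.poincareCartan L (S.sectionCoord Ψ z) = c.hamForm H (z.1, S.mom z) := by
  have hzt := S.fst_mem z hz
  have hy := c.total.map_target hzt
  have hA := hΨ.1 _ _ (S.mem z hz)
  have hmom := FibredChart.momCoord_eq_momenta hy hA
  have hham := ham_eq_energy hL hH hy hA
  rw [c.legCoord_leg hy, c.momCoord_leg hy, c.total.right_inv hzt] at hham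
  rw [c.momCoord_leg hy, c.total.right_inv hzt] at hmom
  change S.mom z = c.momenta L (S.sectionCoord Ψ z) at hmom
  rw [FibredChart.poincareCartan_eq, FibredChart.hamForm, ← hmom, hham]
  rfl

theorem contDiffAt_sectionCoord (hΨ : IsGlobalSection L Ψ)
    {z : (Model n × Model m) × Model k} (hz : z ∈ S.dom) :
    ContDiffAt ℝ ∞ (S.sectionCoord Ψ) z :=
  contDiffAt_fst.prodMk ((hΨ.2 c k S).contDiffAt (S.isOpen_dom.mem_nhds hz))

theorem contDiffAt_mom {z : (Model n × Model m) × Model k} (hz : z ∈ S.dom) :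
    ContDiffAt ℝ ∞ S.mom z :=
  S.smooth_mom.contDiffAt (S.isOpen_dom.mem_nhds hz)

/-- In the coordinates `((x, y), κ)` of the constraint space, `Ψ^* H_L` has the Hamiltonian form with
momenta `mom` and the restricted Hamiltonian; in particular it does not depend on `Ψ`. -/
theorem constrainedForm_eq (hL : IsAlmostRegular L) (hH : WeaklyAssociated H L)
    (hΨ : IsGlobalSection L Ψ) {z : (Model n × Model m) × Model k} (hz : z ∈ S.dom) :
    S.constrainedForm Ψ z =
      (∑ lam, ∑ i, S.mom z lam i •
        wedge (Function.update (fun mu => baseCovector mu) lam (fibreCovector i))) +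
      (-c.ham H.toFun (z.1, S.mom z)) • wedge (fun mu => baseCovector mu) := by
  have hd := (S.contDiffAt_sectionCoord hΨ hz).differentiableAt (by simp)
  set D := fderiv ℝ (S.sectionCoord Ψ) z with hD
  -- `Ψ` is a map over `Y`, so it pulls `dx^λ` and `dy^i` back to `dx^λ` and `dy^i`.
  have hfst : ∀ u, (D u).1 = u.1 := by
    intro u
    have h1 : HasFDerivAt (fun z => (S.sectionCoord Ψ z).1)
        ((ContinuousLinearMap.fst ℝ (Model n × Model m) (Arr n m)).comp D) z :=
      hasFDerivAt_fst.comp z hd.hasFDerivAt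
    exact congrArg (fun F => F u) (h1.unique (hasFDerivAt_fst (p := z)))
  have hdx : ∀ mu, (dxForm mu : Coord n m →L[ℝ] ℝ).comp D = baseCovector mu := fun mu => by
    ext u <;> simp [dxForm, baseCovector, hfst]
  have hdy : ∀ i, (dyForm i : Coord n m →L[ℝ] ℝ).comp D = fibreCovector i := fun i => by
    ext u <;> simp [dyForm, fibreCovector, hfst]
  have hvol : (volForm n m).compContinuousLinearMap D = wedge (fun mu => baseCovector mu) := by
    rw [volForm, wedge_comp]
    simp only [hdx]
  have hom : ∀ lam i, (wedgeOmega (dyForm i : Coord n m →L[ℝ] ℝ) lam).compContinuousLinearMap D =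
      wedge (Function.update (fun mu => baseCovector mu) lam (fibreCovector i)) := by
    intro lam i
    rw [wedgeOmega, wedge_comp]
    congr 1
    ext1 b
    by_cases hb : b = lam
    · subst hb; simp [hdy]
    · simp [hb, hdx]
  rw [constrainedForm, pullback, S.poincareCartan_sectionCoord hL hH hΨ hz, FibredChart.hamForm]
  ext v
  have hvol' := congrArg (fun F => F v) hvol
  have hom' := fun lam i => congrArg (fun F => F v) (hom lam i)
  simp only [ContinuousAlternatingMap.compContinuousLinearMap_apply] at hvol' hom' ⊢
  simp only [ContinuousAlternatingMap.sub_apply, ContinuousAlternatingMap.add_apply,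
    ContinuousAlternatingMap.sum_apply, ContinuousAlternatingMap.smul_apply, smul_eq_mul]
  rw [← hD, hvol']
  simp only [hom']
  ring

end AdaptedChart

/-! ### The constrained Hamilton equations -/

theorem LegSection.isOpen_coordDom (r : LegSection n m π) (c : FibredChart n m π) :
    IsOpen (r.coordDom c) :=
  (c.base.continuousOn_symm.isOpen_inter_preimage c.base.open_target
    (c.total.open_source.preimage r.continuous_point) :)

/-- The Hamiltonian map of a form weakly associated with `L` restricts to a global section of the
Legendre map over the constraint space. -/
theorem exists_isGlobalSection (hH : WeaklyAssociated H L) :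
    ∃ Ψ : ∀ y, LegFibre n m π y → JetFibre n m π y, IsGlobalSection L Ψ := by
  obtain ⟨Φ, hmap, hΦ, -⟩ := hH
  refine ⟨Φ, fun y p ⟨A, hA⟩ => hΦ y A p hA, fun c k S => ?_⟩
  have hcoord : ∀ z ∈ S.dom,
      c.jetCoord (Φ (c.total.symm z.1) (c.leg (c.total.symm z.1) (S.mom z))) =
        fun lam i => fderiv ℝ (c.ham H.toFun) (z.1, S.mom z) (0, unitArr lam i) := by
    intro z hz
    have hzt := S.fst_mem z hz
    have hy := c.total.map_target hzt
    ext lam i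
    rw [hmap c _ hy, c.legCoord_leg hy, c.total.right_inv hzt]
  refine ContDiffOn.congr (fun z hz => ContDiffAt.contDiffWithinAt ?_) hcoord
  refine contDiffAt_pi.2 fun lam => contDiffAt_pi.2 fun i => ?_
  have h1 : ContDiffAt ℝ ∞ (fderiv ℝ (c.ham H.toFun)) (z.1, S.mom z) :=
    (c.contDiffAt_ham H (S.fst_mem z hz)).fderiv_right (by simp)
  have h2 : ContDiffAt ℝ ∞ (fun z => ((z.1, S.mom z) : Coord n m)) z :=
    contDiffAt_fst.prodMk (S.contDiffAt_mom hz)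
  exact (h1.comp z h2).clm_apply contDiffAt_const

/-- Since `Ψ^* H_L` is the restriction of `H`, the constrained equations for the vertical vector `u` are
the Hamilton equations contracted with the image `(u.1, D u)` of `u` in the Legendre bundle. -/
theorem solvesConstrainedHamilton (hL : IsAlmostRegular L) (hH : WeaklyAssociated H L)
    {r : LegSection n m π} (hr : r.SolvesHamilton H) (hrN : r.LivesIn L.constraintSpace)
    {Ψ : ∀ y, LegFibre n m π y → JetFibre n m π y} (hΨ : IsGlobalSection L Ψ) :
    SolvesConstrainedHamilton L Ψ r := by
  intro c k S x hx hxS u hu e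
  have hdomx : ∀ᶠ x' in 𝓝 x, x' ∈ r.coordDom c := (r.isOpen_coordDom c).mem_nhds hx
  have hrsm : ContDiffAt ℝ ∞ (r.coord c) x := (r.smooth c).contDiffAt hdomx
  have hrd := hrsm.differentiableAt (by simp)
  have hnear : ∀ᶠ x' in 𝓝 x, r.coord c x' ∈ S.nbhd :=
    hrsm.continuousAt.eventually (S.isOpen_nbhd.mem_nhds hxS)
  set z := S.restrictedCoord r x
  have hz : z ∈ S.dom := S.mem_dom _ hx.2 _ (hrN _) hxS
  have hmom : ∀ᶠ x' in 𝓝 x, S.mom (S.restrictedCoord r x') = (r.coord c x').2 := by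
    filter_upwards [hdomx, hnear] with x' h1 h2
    exact S.mom_ret _ h1.2 _ (hrN _) h2
  have hzr : ((z.1, S.mom z) : Coord n m) = r.coord c x := Prod.ext rfl hmom.self_of_nhds
  have hbase : ∀ᶠ x' in 𝓝 x, (r.coord c x').1.1 = x' := by
    filter_upwards [hdomx] with x' h1
    change (c.total (r.toFun (c.base.symm x')).1).1 = x'
    rw [c.fst_total _ h1.2, r.proj, c.base.right_inv h1.1]
  -- `R`, `Q` and `D` are the tangent maps of `r` into `Π`, of `r` into `N_L`, and of `N_L → Π` on
  -- momenta; since `r` is the composition of the last two, `D ∘ Q` is the momentum part of `R`.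
  set R := fderiv ℝ (r.coord c) x
  have hRbase : ∀ v, (R v).1.1 = v := by
    intro v
    have h1 : HasFDerivAt (fun x' => (r.coord c x').1.1)
        ((ContinuousLinearMap.fst ℝ (Model n) (Model m)).comp
          ((ContinuousLinearMap.fst ℝ (Model n × Model m) (Arr n m)).comp R)) x :=
      hasFDerivAt_fst.comp x (hasFDerivAt_fst.comp x hrd.hasFDerivAt)
    exact congrArg (fun F => F v)
      ((h1.congr_of_eventuallyEq (hbase.mono fun _ h => h.symm)).unique (hasFDerivAt_id x))
  have hqd : DifferentiableAt ℝ (S.restrictedCoord r) x := by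
    have h1 : DifferentiableAt ℝ S.ret (r.coord c x) :=
      (S.smooth_ret.contDiffAt (S.isOpen_nbhd.mem_nhds hxS)).differentiableAt (by simp)
    exact (differentiableAt_fst.comp x hrd).prodMk (h1.comp x hrd)
  set Q := fderiv ℝ (S.restrictedCoord r) x
  have hQfst : ∀ v, (Q v).1 = (R v).1 := by
    intro v
    have h1 : HasFDerivAt (fun x' => (S.restrictedCoord r x').1)
        ((ContinuousLinearMap.fst ℝ (Model n × Model m) (Model k)).comp Q) x :=
      hasFDerivAt_fst.comp x hqd.hasFDerivAt
    have h2 : HasFDerivAt (fun x' => (r.coord c x').1)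
        ((ContinuousLinearMap.fst ℝ (Model n × Model m) (Arr n m)).comp R) x :=
      hasFDerivAt_fst.comp x hrd.hasFDerivAt
    exact congrArg (fun F => F v) (h1.unique h2)
  have hmd := (S.contDiffAt_mom hz).differentiableAt (by simp)
  set D := fderiv ℝ S.mom z
  have hDQ : ∀ v, D (Q v) = (R v).2 := by
    intro v
    have h1 : HasFDerivAt (fun x' => S.mom (S.restrictedCoord r x')) (D.comp Q) x :=
      HasFDerivAt.comp x hmd.hasFDerivAt hqd.hasFDerivAt
    have h2 : HasFDerivAt (fun x' => (r.coord c x').2)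
        ((ContinuousLinearMap.snd ℝ (Model n × Model m) (Arr n m)).comp R) x :=
      hasFDerivAt_snd.comp x hrd.hasFDerivAt
    exact congrArg (fun F => F v)
      (h1.unique (h2.congr_of_eventuallyEq hmom))
  set dH := fderiv ℝ (c.ham H.toFun) (r.coord c x)
  have hhamd : HasFDerivAt (fun z => c.ham H.toFun (z.1, S.mom z))
      (dH.comp ((ContinuousLinearMap.fst ℝ (Model n × Model m) (Model k)).prod D)) z := by
    have h1 : HasFDerivAt (c.ham H.toFun) dH ((z.1, S.mom z) : Coord n m) := by
      have := ((c.contDiffAt_ham H (w := (z.1, S.mom z)) (S.fst_mem z hz)).differentiableAt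
        (by simp)).hasFDerivAt
      rwa [hzr] at this ⊢
    exact HasFDerivAt.comp (g := c.ham H.toFun) z h1 (hasFDerivAt_fst.prodMk hmd.hasFDerivAt)
  obtain ⟨hham1, hham2⟩ : (∀ (lam : Fin n) (i : Fin m),
      (R (EuclideanSpace.single lam 1)).1.2 i = dH (0, unitArr lam i)) ∧
      ∀ i : Fin m, ∑ lam, (R (EuclideanSpace.single lam 1)).2 lam i =
        -dH ((0, EuclideanSpace.single i 1), 0) := hr c x hx
  have hloc : S.constrainedForm Ψ =ᶠ[𝓝 z] fun z =>
      (∑ lam, ∑ i, S.mom z lam i •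
        wedge (Function.update (fun mu => baseCovector mu) lam (fibreCovector i))) +
      (-c.ham H.toFun (z.1, S.mom z)) • wedge (fun mu => baseCovector mu) := by
    filter_upwards [S.isOpen_dom.mem_nhds hz] with z' hz'
    exact S.constrainedForm_eq hL hH hΨ hz'
  -- `d𝓗` of the vertical vector `u` is the sum of the right-hand sides of the Hamilton equations.
  have hdHu : dH (u.1, D u) =
      (∑ lam, ∑ i, D u lam i * (R (EuclideanSpace.single lam 1)).1.2 i) -
        ∑ i, u.1.2 i * ∑ lam, (R (EuclideanSpace.single lam 1)).2 lam i := by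
    have hsplit : ((u.1, D u) : Coord n m) =
        ContinuousLinearMap.inr ℝ (Model n × Model m) (Arr n m) (D u) +
        (ContinuousLinearMap.inl ℝ (Model n × Model m) (Arr n m)).comp
          (ContinuousLinearMap.inr ℝ (Model n) (Model m)) u.1.2 := by
      refine Prod.ext (Prod.ext ?_ ?_) ?_ <;> simp [hu]
    have hv : dH (ContinuousLinearMap.inr ℝ (Model n × Model m) (Arr n m) (D u)) =
        ∑ lam, ∑ i, D u lam i * (R (EuclideanSpace.single lam 1)).1.2 i := by
      conv_lhs => rw [arr_eq_sum (D u)]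
      simp only [map_sum, map_smul, smul_eq_mul]
      simp only [hham1]
      rfl
    have hh : dH ((ContinuousLinearMap.inl ℝ (Model n × Model m) (Arr n m)).comp
          (ContinuousLinearMap.inr ℝ (Model n) (Model m)) u.1.2) =
        -∑ i, u.1.2 i * ∑ lam, (R (EuclideanSpace.single lam 1)).2 lam i := by
      conv_lhs => rw [model_eq_sum u.1.2]
      simp only [map_sum, map_smul, smul_eq_mul]
      simp only [hham2, mul_neg, Finset.sum_neg_distrib, neg_neg]
      rfl
    rw [hsplit, map_add, hv, hh, sub_eq_add_neg]
  have hmd' : HasFDerivAt S.mom D z := hmd.hasFDerivAt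
  rw [hloc.extDeriv_eq, extDeriv_hamiltonian_cons hmd' hhamd hu
    (fun v => by rw [hQfst, hRbase]) e]
  have hK : (dH.comp ((ContinuousLinearMap.fst ℝ (Model n × Model m) (Model k)).prod D)) u =
      dH (u.1, D u) := rfl
  simp only [hDQ, hQfst, hK, hdHu, sub_self, mul_zero]

end Constrained

end Polysymplectic

open Polysymplectic in
theorem theorem4 {n m : ℕ} {X Y M : Type*}
    [TopologicalSpace X] [ChartedSpace (Model n) X] [IsManifold 𝓘(ℝ, Model n) ∞ X]
    [T2Space X] [SecondCountableTopology X] [ConnectedSpace X]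
    [TopologicalSpace Y] [ChartedSpace (Model n × Model m) Y]
    [IsManifold 𝓘(ℝ, Model n × Model m) ∞ Y]
    [T2Space Y] [SecondCountableTopology Y] [ConnectedSpace Y]
    [TopologicalSpace M] [ChartedSpace (Model m) M] [IsManifold 𝓘(ℝ, Model m) ∞ M]
    [T2Space M] [SecondCountableTopology M] [ConnectedSpace M]
    (π : Y → X) (hπ : IsSmoothFibreBundle n m M π)
    (L : Lagrangian n m π) (hL : IsAlmostRegular L)
    (H : HamiltonianForm n m π) (hH : WeaklyAssociated H L) :
    (∃ Ψ : ∀ y, LegFibre n m π y → JetFibre n m π y, IsGlobalSection L Ψ) ∧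
    ∀ r : LegSection n m π, r.SolvesHamilton H → r.LivesIn L.constraintSpace →
      ∀ Ψ : ∀ y, LegFibre n m π y → JetFibre n m π y, IsGlobalSection L Ψ →
        SolvesConstrainedHamilton L Ψ r := by
  exact ⟨exists_isGlobalSection hH, fun r hr hrN Ψ hΨ =>
    solvesConstrainedHamilton hL hH hr hrN hΨ⟩
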